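/- Let $(M,g,J)$ be a Hermitian manifold: $M$ is a smooth manifold, $g$ a smooth Riemannian metric (also written $\langle\cdot,\cdot\rangle$), and $J$ a smooth integrable almost complex structure on $TM$ with $g(JX,JY)=g(X,Y)$. Let $\omega(X,Y)=g(JX,Y)$, let $\nabla^{LC}$ be the Levi-Civita connection, and let $\nabla^{SB}$ be the Strominger–Bismut connection, i.e. the connection on $TM$ given by $$g(\nabla^{SB}_XY,Z)=g(\nabla^{LC}_XY,Z)+\tfrac12\,(d\omega)(JX,JY,JZ),$$ with torsion $T^{SB}(X,Y,Z)=g(\nabla^{SB}_XY-\nabla^{SB}_YX-[X,Y],Z)$ and curvature $R^{SB}(X,Y,Z,W)=g(\nabla^{SB}_X\nabla^{SB}_YZ-\nabla^{SB}_Y\nabla^{SB}_XZ-\nabla^{SB}_{[X,Y]}Z,W)$. Let $a<b$, let $\gamma:[a,b]\to M$ be a unit speed geodesic of $g$, and let $\alpha:[a,b]\times(-\varepsilon_1,\varepsilon_1)\times(-\varepsilon_2,\varepsilon_2)\to M$, $(t,s_1,s_2)\mapsto\alpha(t,s_1,s_2)$, be a smooth variation of $\gamma$, i.e. $\alpha(t,0,0)=\gamma(t)$,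 with variational vector fields $V=\alpha_*(\partial/\partial s_1)|_{s_1=s_2=0}$ and $W=\alpha_*(\partial/\partial s_2)|_{s_1=s_2=0}$. Let $\hat\nabla^{SB}$ and $\bar\nabla^{SB}$ be the connections induced by $\nabla^{SB}$ on $\gamma^*TM$ and $\alpha^*TM$, and let $E(\alpha)(s_1,s_2)=\frac12\int_a^b|\alpha_*(\partial/\partial t)|^2\,dt$ be the energy of the curve $\alpha(\cdot,s_1,s_2)$. Then the mixed second derivative of $E(\alpha)$ at $s_1=s_2=0$ exists and $$\frac{\partial^2E(\alpha)}{\partial s_1\partial s_2}\bigg|_{s_1=s_2=0}=\int_a^b\Big\{\big\langle\hat\nabla^{SB}_{\frac{d}{dt}}V,\hat\nabla^{SB}_{\frac{d}{dt}}W\big\rangle+T^{SB}\big(V,\gamma',\hat\nabla^{SB}_{\frac{d}{dt}}W\big)-R^{SB}(V,\gamma',\gamma',W)\Big\}\,dt+\Big\langle\Big(\bar\nabla^{SB}_{\frac{\partial}{\partial s_1}}\alpha_*\big(\tfrac{\partial}{\partial s_2}\big)\Big)\Big|_{s_1=s_2=0},\gamma'\Big\rangle\Big|_{t=a}^{t=b}.$$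 If moreover $\alpha$ is a proper variation, i.e. $\alpha(a,s_1,s_2)=\gamma(a)$ and $\alpha(b,s_1,s_2)=\gamma(b)$ for all $s_1,s_2$, then $$\frac{\partial^2E(\alpha)}{\partial s_1\partial s_2}\bigg|_{s_1=s_2=0}=\int_a^b\Big\{\big\langle\hat\nabla^{SB}_{\frac{d}{dt}}V,\hat\nabla^{SB}_{\frac{d}{dt}}W\big\rangle+T^{SB}\big(V,\gamma',\hat\nabla^{SB}_{\frac{d}{dt}}W\big)-R^{SB}(V,\gamma',\gamma',W)\Big\}\,dt.$$ -/

import Mathlib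

open Bundle FiberBundle Set VectorField MeasureTheory
open scoped Manifold ContDiff Topology

noncomputable section

set_option linter.unusedSectionVars false

namespace Hermitian

variable {E : Type*} [NormedAddCommGroup E] [NormedSpace ℝ E]
  [FiniteDimensional ℝ E] [CompleteSpace E]
  {M : Type*} [TopologicalSpace M] [ChartedSpace E M] [IsManifold 𝓘(ℝ, E) ∞ M]
  [RiemannianBundle (fun x : M ↦ TangentSpace 𝓘(ℝ, E) x)]
  [IsContMDiffRiemannianBundle 𝓘(ℝ, E) ∞ E (fun x : M ↦ TangentSpace 𝓘(ℝ, E) x)]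

/-! ### The Levi-Civita connection -/

/-- The Koszul expression, equal to `g(∇_X Y, Z)` at the point `x`. -/
def koszul (X Y Z : Π x : M, TangentSpace 𝓘(ℝ, E) x) (x : M) : ℝ :=
  (1 / 2 : ℝ) *
    (mvfderiv 𝓘(ℝ, E) (fun y ↦ inner ℝ (Y y) (Z y)) x (X x)
      + mvfderiv 𝓘(ℝ, E) (fun y ↦ inner ℝ (X y) (Z y)) x (Y x)
      - mvfderiv 𝓘(ℝ, E) (fun y ↦ inner ℝ (X y) (Y y)) x (Z x)
      + inner ℝ (mlieBracket 𝓘(ℝ, E) X Y x) (Z x)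
      - inner ℝ (mlieBracket 𝓘(ℝ, E) X Z x) (Y x)
      - inner ℝ (mlieBracket 𝓘(ℝ, E) Y Z x) (X x))

variable {X X' Y Y' Z : Π x : M, TangentSpace 𝓘(ℝ, E) x} {x : M}

theorem mdiffAt_inner (hX : MDiffAt (T% X) x) (hY : MDiffAt (T% Y) x) :
    MDiffAt (fun y ↦ inner ℝ (X y) (Y y)) x :=
  MDifferentiableAt.inner_bundle (IB := 𝓘(ℝ, E)) (F := E)
    (E := fun x : M ↦ TangentSpace 𝓘(ℝ, E) x) hX hY

theorem koszul_tensorial_left (hY : MDiffAt (T% Y) x) (hZ : MDiffAt (T% Z) x) :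
    TensorialAt 𝓘(ℝ, E) E (fun X ↦ koszul X Y Z x) x where
  smul {f X} hf hX := by
    simp [koszul, mvfderiv_fun_mul hf (mdiffAt_inner hX hZ), inner_smul_left,
      mvfderiv_fun_mul hf (mdiffAt_inner hX hY), mlieBracket_smul_left hf hX, inner_add_left,
      inner_smul_right]
    rw [real_inner_comm (Z x) (X x), real_inner_comm (Y x) (X x)]
    ring
  add {X X'} hX hX' := by
    simp [koszul, mvfderiv_fun_add (mdiffAt_inner hX hZ) (mdiffAt_inner hX' hZ),
      mvfderiv_fun_add (mdiffAt_inner hX hY) (mdiffAt_inner hX' hY), mlieBracket_add_left hX hX',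
      inner_add_left, inner_add_right]
    ring

theorem koszul_tensorial_right (hX : MDiffAt (T% X) x) (hY : MDiffAt (T% Y) x) :
    TensorialAt 𝓘(ℝ, E) E (fun Z ↦ koszul X Y Z x) x where
  smul {f Z} hf hZ := by
    simp [koszul, mvfderiv_fun_mul hf (mdiffAt_inner hX hZ), inner_smul_left,
      mvfderiv_fun_mul hf (mdiffAt_inner hY hZ), mlieBracket_smul_right hf hZ, inner_add_left,
      inner_smul_right]
    rw [real_inner_comm (X x) (Z x), real_inner_comm (Y x) (Z x)]
    ring
  add {Z Z'} hZ hZ' := by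
    simp [koszul, mvfderiv_fun_add (mdiffAt_inner hX hZ) (mdiffAt_inner hX hZ'),
      mvfderiv_fun_add (mdiffAt_inner hY hZ) (mdiffAt_inner hY hZ'), mlieBracket_add_right hZ hZ',
      inner_add_left, inner_add_right]
    ring

/-- The continuous bilinear form `(X, Z) ↦ g(∇_X Y, Z)` at `x`, for `Y` differentiable at `x`. -/
def koszulForm (Y : Π x : M, TangentSpace 𝓘(ℝ, E) x) (x : M) (hY : MDiffAt (T% Y) x) :
    TangentSpace 𝓘(ℝ, E) x →L[ℝ] TangentSpace 𝓘(ℝ, E) x →L[ℝ] ℝ :=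
  TensorialAt.mkHom₂ (fun X Z ↦ koszul X Y Z x) x
    (fun _ hZ ↦ koszul_tensorial_left hY hZ) (fun _ hX ↦ koszul_tensorial_right hX hY)

theorem koszul_add_middle (hX : MDiffAt (T% X) x) (hY : MDiffAt (T% Y) x)
    (hY' : MDiffAt (T% Y') x) (hZ : MDiffAt (T% Z) x) :
    koszul X (Y + Y') Z x = koszul X Y Z x + koszul X Y' Z x := by
  simp [koszul, mvfderiv_fun_add (mdiffAt_inner hX hY) (mdiffAt_inner hX hY'),
    mvfderiv_fun_add (mdiffAt_inner hY hZ) (mdiffAt_inner hY' hZ), mlieBracket_add_right hY hY',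
    mlieBracket_add_left hY hY', inner_add_left, inner_add_right]
  ring

theorem koszul_smul_middle {f : M → ℝ} (hf : MDiffAt f x) (hX : MDiffAt (T% X) x)
    (hY : MDiffAt (T% Y) x) (hZ : MDiffAt (T% Z) x) :
    koszul X (f • Y) Z x =
      f x * koszul X Y Z x + mvfderiv 𝓘(ℝ, E) f x (X x) * inner ℝ (Y x) (Z x) := by
  simp [koszul, mvfderiv_fun_mul hf (mdiffAt_inner hX hY), inner_smul_left,
    mvfderiv_fun_mul hf (mdiffAt_inner hY hZ), mlieBracket_smul_right hf hY,
    mlieBracket_smul_left hf hY, inner_add_left, inner_smul_right]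
  rw [real_inner_comm (X x) (Y x)]
  ring

instance finiteDimensional_tangentSpace (x : M) : FiniteDimensional ℝ (TangentSpace 𝓘(ℝ, E) x) :=
  inferInstanceAs (FiniteDimensional ℝ E)

instance completeSpace_tangentSpace (x : M) : CompleteSpace (TangentSpace 𝓘(ℝ, E) x) :=
  FiniteDimensional.complete ℝ _

/-- The musical isomorphism at `x`: the tangent vector representing a covector. -/
def sharp (x : M) : (TangentSpace 𝓘(ℝ, E) x →L[ℝ] ℝ) →L[ℝ] TangentSpace 𝓘(ℝ, E) x :=
  LinearMap.toContinuousLinearMap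
    { toFun := fun φ ↦ (InnerProductSpace.toDual ℝ (TangentSpace 𝓘(ℝ, E) x)).symm φ
      map_add' := fun φ ψ ↦ map_add _ φ ψ
      map_smul' := fun c φ ↦ by simp }

theorem inner_sharp (x : M) (φ : TangentSpace 𝓘(ℝ, E) x →L[ℝ] ℝ) (v : TangentSpace 𝓘(ℝ, E) x) :
    inner ℝ (sharp x φ) v = φ v :=
  InnerProductSpace.toDual_symm_apply

open Classical in
/-- The Levi-Civita connection of the Riemannian metric, given by the Koszul formula.
`leviCivita Y x v` is `∇_v Y` at `x`. -/
def leviCivita : CovariantDerivative 𝓘(ℝ, E) E (fun x : M ↦ TangentSpace 𝓘(ℝ, E) x) where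
  toFun Y x := if hY : MDiffAt (T% Y) x then (sharp x).comp (koszulForm Y x hY) else 0
  isCovariantDerivativeOnUniv :=
    { add := by
        intro Y Y' x hY hY' _
        have hYY : MDiffAt (T% (Y + Y')) x := mdifferentiableAt_add_section hY hY'
        rw [dif_pos hY, dif_pos hY', dif_pos hYY]
        refine ContinuousLinearMap.ext fun v ↦ ext_inner_right ℝ fun w ↦ ?_
        simp only [ContinuousLinearMap.comp_apply, add_apply, inner_add_left,
          inner_sharp, koszulForm, TensorialAt.mkHom₂_apply_eq_extend]
        exact koszul_add_middle (mdifferentiableAt_extend ..) hY hY' (mdifferentiableAt_extend ..)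
      leibniz := by
        intro Y f x hY hf _
        have hfY : MDiffAt (T% (f • Y)) x := hf.smul_section hY
        rw [dif_pos hY, dif_pos hfY]
        refine ContinuousLinearMap.ext fun v ↦ ext_inner_right ℝ fun w ↦ ?_
        simp only [ContinuousLinearMap.comp_apply, add_apply, inner_add_left,
          smul_apply, ContinuousLinearMap.smulRight_apply, real_inner_smul_left,
          inner_sharp, koszulForm, TensorialAt.mkHom₂_apply_eq_extend]
        rw [koszul_smul_middle hf (mdifferentiableAt_extend ..) hY (mdifferentiableAt_extend ..)]
        simp }

/-! ### Hermitian structures -/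

variable (E M) in
/-- A Hermitian structure on the Riemannian manifold `M`: a smooth almost complex structure `J`
that is integrable (its Nijenhuis tensor vanishes) and orthogonal for the metric. -/
structure HermitianStructure where
  J : Π x : M, TangentSpace 𝓘(ℝ, E) x →L[ℝ] TangentSpace 𝓘(ℝ, E) x
  contMDiff_J : ContMDiff 𝓘(ℝ, E) (𝓘(ℝ, E).prod 𝓘(ℝ, E →L[ℝ] E)) ∞
    (fun x ↦ TotalSpace.mk' (E →L[ℝ] E)
      (E := fun x : M ↦ TangentSpace 𝓘(ℝ, E) x →L[ℝ] TangentSpace 𝓘(ℝ, E) x) x (J x))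
  J_J (x : M) (v : TangentSpace 𝓘(ℝ, E) x) : J x (J x v) = -v
  integrable (X Y : Π x : M, TangentSpace 𝓘(ℝ, E) x) (x : M) :
    MDiffAt (T% X) x → MDiffAt (T% Y) x →
    mlieBracket 𝓘(ℝ, E) (fun y ↦ J y (X y)) (fun y ↦ J y (Y y)) x
      - J x (mlieBracket 𝓘(ℝ, E) (fun y ↦ J y (X y)) Y x)
      - J x (mlieBracket 𝓘(ℝ, E) X (fun y ↦ J y (Y y)) x)
      - mlieBracket 𝓘(ℝ, E) X Y x = 0
  inner_J_J (x : M) (v w : TangentSpace 𝓘(ℝ, E) x) : inner ℝ (J x v) (J x w) = inner ℝ v w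

namespace HermitianStructure

variable (h : HermitianStructure E M)

/-- The fundamental 2-form `ω(v, w) = g(Jv, w)`. -/
def omega (x : M) (v w : TangentSpace 𝓘(ℝ, E) x) : ℝ := inner ℝ (h.J x v) w

/-- The exterior derivative `dω` evaluated on three vector fields, at the point `x`. -/
def extDerivOmegaAux (X Y Z : Π x : M, TangentSpace 𝓘(ℝ, E) x) (x : M) : ℝ :=
  mvfderiv 𝓘(ℝ, E) (fun y ↦ h.omega y (Y y) (Z y)) x (X x)
    - mvfderiv 𝓘(ℝ, E) (fun y ↦ h.omega y (X y) (Z y)) x (Y x)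
    + mvfderiv 𝓘(ℝ, E) (fun y ↦ h.omega y (X y) (Y y)) x (Z x)
    - h.omega x (mlieBracket 𝓘(ℝ, E) X Y x) (Z x)
    + h.omega x (mlieBracket 𝓘(ℝ, E) X Z x) (Y x)
    - h.omega x (mlieBracket 𝓘(ℝ, E) Y Z x) (X x)

variable {h}

theorem omega_swap (v w : TangentSpace 𝓘(ℝ, E) x) : h.omega x v w = -h.omega x w v := by
  unfold omega
  rw [← h.inner_J_J x (h.J x v) w, h.J_J, inner_neg_left, real_inner_comm]

theorem mdiffAt_J (hX : MDiffAt (T% X) x) : MDiffAt (T% (fun y ↦ h.J y (X y))) x :=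
  MDifferentiableAt.clm_bundle_apply (F₁ := E) (F₂ := E)
    (E₁ := fun x : M ↦ TangentSpace 𝓘(ℝ, E) x) (E₂ := fun x : M ↦ TangentSpace 𝓘(ℝ, E) x)
    (h.contMDiff_J.mdifferentiableAt (by simp)) hX

theorem mdiffAt_omega (hX : MDiffAt (T% X) x) (hY : MDiffAt (T% Y) x) :
    MDiffAt (fun y ↦ h.omega y (X y) (Y y)) x :=
  mdiffAt_inner (mdiffAt_J hX) hY

theorem extDerivOmegaAux_tensorial₁ (hY : MDiffAt (T% Y) x) (hZ : MDiffAt (T% Z) x) :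
    TensorialAt 𝓘(ℝ, E) E (fun X ↦ h.extDerivOmegaAux X Y Z x) x where
  smul {f X} hf hX := by
    have h1 (y : M) (c : ℝ) (v w : TangentSpace 𝓘(ℝ, E) y) :
        h.omega y (c • v) w = c * h.omega y v w := by simp [omega, inner_smul_left]
    have h2 (y : M) (c : ℝ) (v w : TangentSpace 𝓘(ℝ, E) y) :
        h.omega y v (c • w) = c * h.omega y v w := by simp [omega, inner_smul_right]
    have h3 (y : M) (u v w : TangentSpace 𝓘(ℝ, E) y) :
        h.omega y (u + v) w = h.omega y u w + h.omega y v w := by simp [omega, inner_add_left]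
    have h4 (y : M) (v w : TangentSpace 𝓘(ℝ, E) y) : h.omega y (-v) w = -h.omega y v w := by
      simp [omega]
    simp [extDerivOmegaAux, h1, h2, h3, h4, mvfderiv_fun_mul hf (mdiffAt_omega hX hZ),
      mvfderiv_fun_mul hf (mdiffAt_omega hX hY), mlieBracket_smul_left hf hX]
    ring
  add {X X'} hX hX' := by
    have h3 (y : M) (u v w : TangentSpace 𝓘(ℝ, E) y) :
        h.omega y (u + v) w = h.omega y u w + h.omega y v w := by simp [omega, inner_add_left]
    have h4 (y : M) (u v w : TangentSpace 𝓘(ℝ, E) y) :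
        h.omega y w (u + v) = h.omega y w u + h.omega y w v := by simp [omega, inner_add_right]
    simp [extDerivOmegaAux, h3, h4, mvfderiv_fun_add (mdiffAt_omega hX hZ) (mdiffAt_omega hX' hZ),
      mvfderiv_fun_add (mdiffAt_omega hX hY) (mdiffAt_omega hX' hY), mlieBracket_add_left hX hX']
    ring

theorem extDerivOmegaAux_swap₁₂ :
    h.extDerivOmegaAux X Y Z x = -h.extDerivOmegaAux Y X Z x := by
  have h1 : (fun y ↦ h.omega y (X y) (Y y)) = -fun y ↦ h.omega y (Y y) (X y) :=
    funext fun y ↦ omega_swap _ _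
  have h2 (v w : TangentSpace 𝓘(ℝ, E) x) : h.omega x (-v) w = -h.omega x v w := by simp [omega]
  simp only [extDerivOmegaAux]
  rw [h1, mvfderiv_neg, mlieBracket_swap_apply (V := X) (W := Y), h2]
  simp only [neg_apply]
  ring

theorem extDerivOmegaAux_swap₂₃ :
    h.extDerivOmegaAux X Y Z x = -h.extDerivOmegaAux X Z Y x := by
  have h1 : (fun y ↦ h.omega y (Y y) (Z y)) = -fun y ↦ h.omega y (Z y) (Y y) :=
    funext fun y ↦ omega_swap _ _
  have h2 (v w : TangentSpace 𝓘(ℝ, E) x) : h.omega x (-v) w = -h.omega x v w := by simp [omega]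
  simp only [extDerivOmegaAux]
  rw [h1, mvfderiv_neg, mlieBracket_swap_apply (V := Y) (W := Z), h2]
  simp only [neg_apply]
  ring

theorem extDerivOmegaAux_tensorial₂ (hX : MDiffAt (T% X) x) (hZ : MDiffAt (T% Z) x) :
    TensorialAt 𝓘(ℝ, E) E (fun Y ↦ h.extDerivOmegaAux X Y Z x) x where
  smul {f Y} hf hY := by
    simp only [extDerivOmegaAux_swap₁₂ (X := X)]
    simp only [(extDerivOmegaAux_tensorial₁ hX hZ).smul hf hY, smul_neg]
  add {Y Y'} hY hY' := by
    simp only [extDerivOmegaAux_swap₁₂ (X := X)]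
    simp only [(extDerivOmegaAux_tensorial₁ hX hZ).add hY hY', neg_add]

theorem extDerivOmegaAux_tensorial₃ (hX : MDiffAt (T% X) x) (hY : MDiffAt (T% Y) x) :
    TensorialAt 𝓘(ℝ, E) E (fun Z ↦ h.extDerivOmegaAux X Y Z x) x where
  smul {f Z} hf hZ := by
    simp only [extDerivOmegaAux_swap₂₃ (Y := Y)]
    simp only [(extDerivOmegaAux_tensorial₂ hX hY).smul hf hZ, smul_neg]
  add {Z Z'} hZ hZ' := by
    simp only [extDerivOmegaAux_swap₂₃ (Y := Y)]
    simp only [(extDerivOmegaAux_tensorial₂ hX hY).add hZ hZ', neg_add]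

variable (h)

/-- The 3-form `dω` at `x`. Its value on three tangent vectors does not depend on the differentiable
extensions to vector fields that are used to compute it; here they are the standard ones. -/
def extDerivOmega (x : M) (u v w : TangentSpace 𝓘(ℝ, E) x) : ℝ :=
  h.extDerivOmegaAux (extend E u) (extend E v) (extend E w) x

variable {h}

theorem extDerivOmega_swap₁₂ (u v w : TangentSpace 𝓘(ℝ, E) x) :
    h.extDerivOmega x u v w = -h.extDerivOmega x v u w :=
  extDerivOmegaAux_swap₁₂

theorem extDerivOmega_swap₂₃ (u v w : TangentSpace 𝓘(ℝ, E) x) :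
    h.extDerivOmega x u v w = -h.extDerivOmega x u w v :=
  extDerivOmegaAux_swap₂₃

theorem extDerivOmega_add₁ (u u' v w : TangentSpace 𝓘(ℝ, E) x) :
    h.extDerivOmega x (u + u') v w = h.extDerivOmega x u v w + h.extDerivOmega x u' v w :=
  (TensorialAt.mkHom _ _ (h.extDerivOmegaAux_tensorial₁ (x := x) (Y := extend E v)
    (Z := extend E w) (mdifferentiableAt_extend ..) (mdifferentiableAt_extend ..))).map_add u u'

theorem extDerivOmega_smul₁ (c : ℝ) (u v w : TangentSpace 𝓘(ℝ, E) x) :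
    h.extDerivOmega x (c • u) v w = c * h.extDerivOmega x u v w :=
  (TensorialAt.mkHom _ _ (h.extDerivOmegaAux_tensorial₁ (x := x) (Y := extend E v)
    (Z := extend E w) (mdifferentiableAt_extend ..) (mdifferentiableAt_extend ..))).map_smul c u

theorem extDerivOmega_add₂ (u v v' w : TangentSpace 𝓘(ℝ, E) x) :
    h.extDerivOmega x u (v + v') w = h.extDerivOmega x u v w + h.extDerivOmega x u v' w := by
  simp only [extDerivOmega_swap₁₂ u, extDerivOmega_add₁, neg_add]

theorem extDerivOmega_smul₂ (c : ℝ) (u v w : TangentSpace 𝓘(ℝ, E) x) :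
    h.extDerivOmega x u (c • v) w = c * h.extDerivOmega x u v w := by
  simp only [extDerivOmega_swap₁₂ u, extDerivOmega_smul₁, mul_neg]

variable (h)

/-- The covector `w ↦ dω(u, v, w)`. -/
def extDerivOmegaCovector (x : M) (u v : TangentSpace 𝓘(ℝ, E) x) :
    TangentSpace 𝓘(ℝ, E) x →L[ℝ] ℝ :=
  LinearMap.toContinuousLinearMap
    { toFun := fun w ↦ h.extDerivOmega x u v w
      map_add' := fun w w' ↦ by
        simp only [extDerivOmega_swap₂₃ u v, extDerivOmega_add₂, neg_add]
      map_smul' := fun c w ↦ by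
        simp only [extDerivOmega_swap₂₃ u v, extDerivOmega_smul₂, mul_neg, RingHom.id_apply,
          smul_eq_mul] }

/-- The vector `A` with `g(A, Z) = (1/2) dω(JX, JY, JZ)` for all `Z`. -/
def bismutVector (x : M) (X Y : TangentSpace 𝓘(ℝ, E) x) : TangentSpace 𝓘(ℝ, E) x :=
  (1 / 2 : ℝ) • sharp x ((h.extDerivOmegaCovector x (h.J x X) (h.J x Y)).comp (h.J x))

theorem inner_bismutVector (x : M) (X Y Z : TangentSpace 𝓘(ℝ, E) x) :
    inner ℝ (h.bismutVector x X Y) Z =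
      (1 / 2 : ℝ) * h.extDerivOmega x (h.J x X) (h.J x Y) (h.J x Z) := by
  simp only [bismutVector, real_inner_smul_left, inner_sharp]
  rfl

/-- `bismutForm x Y X` is `bismutVector x X Y`, as a tensor. -/
def bismutForm (x : M) : TangentSpace 𝓘(ℝ, E) x →L[ℝ] TangentSpace 𝓘(ℝ, E) x →L[ℝ]
    TangentSpace 𝓘(ℝ, E) x :=
  LinearMap.toContinuousLinearMap
    { toFun := fun Y ↦ LinearMap.toContinuousLinearMap
        { toFun := fun X ↦ h.bismutVector x X Y
          map_add' := fun X X' ↦ ext_inner_right ℝ fun Z ↦ by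
            simp only [inner_add_left, inner_bismutVector, map_add, extDerivOmega_add₁, mul_add]
          map_smul' := fun c X ↦ ext_inner_right ℝ fun Z ↦ by
            simp only [real_inner_smul_left, inner_bismutVector, map_smul, extDerivOmega_smul₁,
              RingHom.id_apply]
            ring }
      map_add' := fun Y Y' ↦ ContinuousLinearMap.ext fun X ↦ ext_inner_right ℝ fun Z ↦ by
        simp only [add_apply, LinearMap.coe_toContinuousLinearMap', LinearMap.coe_mk, AddHom.coe_mk,
          inner_add_left, inner_bismutVector, map_add, extDerivOmega_add₂, mul_add]
      map_smul' := fun c Y ↦ ContinuousLinearMap.ext fun X ↦ ext_inner_right ℝ fun Z ↦ by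
        simp only [smul_apply, LinearMap.coe_toContinuousLinearMap', LinearMap.coe_mk,
          AddHom.coe_mk, real_inner_smul_left, inner_bismutVector, map_smul, extDerivOmega_smul₂,
          RingHom.id_apply]
        ring }

/-- The Strominger–Bismut connection, characterized by
`g(∇^SB_X Y, Z) = g(∇^LC_X Y, Z) + (1/2) dω(JX, JY, JZ)`. -/
def stromingerBismut : CovariantDerivative 𝓘(ℝ, E) E (fun x : M ↦ TangentSpace 𝓘(ℝ, E) x) :=
  leviCivita.addOneForm h.bismutForm

end HermitianStructure

/-! ### Curvature, and the connection induced on a pull-back bundle -/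

/-- The curvature `R(u, v)w = ∇_u ∇_v w - ∇_v ∇_u w - ∇_[u,v] w` of a connection on the tangent
bundle, at `x`. As it is tensorial, it is computed with the standard extensions of the three vectors
to vector fields. -/
def curvature (cov : CovariantDerivative 𝓘(ℝ, E) E (fun x : M ↦ TangentSpace 𝓘(ℝ, E) x))
    (x : M) (u v w : TangentSpace 𝓘(ℝ, E) x) : TangentSpace 𝓘(ℝ, E) x :=
  cov (fun y ↦ cov (extend E w) y (extend E v y)) x u
    - cov (fun y ↦ cov (extend E w) y (extend E u y)) x v
    - cov (extend E w) x (mlieBracket 𝓘(ℝ, E) (extend E u) (extend E v) x)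

/-- The connection induced by `cov` on the pull-back `f^*TM` of the tangent bundle by a map `f` which
is defined on the subset `S` of a normed space: the derivative at `p`, in the direction `v`, of the
vector field `V` along `f`. In the local frame `(e_i)` of `TM` given by the trivialization at `f p`,
where `V = ∑ V^i e_i ∘ f`, this is `∑ (dV^i(v) e_i + V^i ∇_{df(v)} e_i)`. The section
`extend E (V p)` in the second term is the one with constant coefficients in this frame. -/
def covDerivAlong (cov : CovariantDerivative 𝓘(ℝ, E) E (fun x : M ↦ TangentSpace 𝓘(ℝ, E) x))
    {P : Type*} [NormedAddCommGroup P] [NormedSpace ℝ P] (f : P → M) (S : Set P)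
    (V : Π p : P, TangentSpace 𝓘(ℝ, E) (f p)) (p v : P) : TangentSpace 𝓘(ℝ, E) (f p) :=
  (trivializationAt E (fun x : M ↦ TangentSpace 𝓘(ℝ, E) x) (f p)).symm (f p)
      (fderivWithin ℝ (fun q ↦ (trivializationAt E (fun x : M ↦ TangentSpace 𝓘(ℝ, E) x) (f p)
        (TotalSpace.mk' E (f q) (V q))).2) S p v)
    + cov (extend E (V p)) (f p) (mfderivWithin 𝓘(ℝ, P) 𝓘(ℝ, E) f S p v)

/-! ### Curves, energy and variations -/

/-- The velocity `γ'(t)` of a curve `γ : [a, b] → M`. -/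
def velocity (a b : ℝ) (γ : ℝ → M) (t : ℝ) : TangentSpace 𝓘(ℝ, E) (γ t) :=
  mfderivWithin 𝓘(ℝ, ℝ) 𝓘(ℝ, E) γ (Icc a b) t (1 : ℝ)

variable (E) in
/-- `γ : [a, b] → M` is a geodesic of the Riemannian metric, of unit speed. -/
structure IsUnitSpeedGeodesic (a b : ℝ) (γ : ℝ → M) : Prop where
  contMDiffOn : ContMDiffOn 𝓘(ℝ, ℝ) 𝓘(ℝ, E) ∞ γ (Icc a b)
  norm_velocity : ∀ t ∈ Icc a b, ‖velocity (E := E) a b γ t‖ = 1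
  geodesic : ∀ t ∈ Icc a b,
    covDerivAlong (E := E) leviCivita γ (Icc a b) (velocity a b γ) t 1 = 0

variable (E) in
/-- The energy `(1/2) ∫_a^b |γ'(t)|² dt` of a curve. -/
def energy (a b : ℝ) (γ : ℝ → M) : ℝ :=
  (1 / 2 : ℝ) * ∫ t in a..b, ‖velocity (E := E) a b γ t‖ ^ 2

/-- The domain `[a, b] × (-ε₁, ε₁) × (-ε₂, ε₂)` of a two-parameter variation; its points are written
`(t, s₁, s₂)`. -/
def variationDomain (a b ε₁ ε₂ : ℝ) : Set (ℝ × ℝ × ℝ) :=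
  Icc a b ×ˢ Ioo (-ε₁) ε₁ ×ˢ Ioo (-ε₂) ε₂

/-- The vector field `α_*(v)` along the map `α` with domain `D`, for a constant vector `v`. It is
`α_*(∂/∂t)`, `α_*(∂/∂s₁)`, `α_*(∂/∂s₂)` for `v` equal to `(1, 0, 0)`, `(0, 1, 0)`, `(0, 0, 1)`. -/
def pushforward (D : Set (ℝ × ℝ × ℝ)) (α : ℝ × ℝ × ℝ → M) (v : ℝ × ℝ × ℝ) (p : ℝ × ℝ × ℝ) :
    TangentSpace 𝓘(ℝ, E) (α p) :=
  mfderivWithin 𝓘(ℝ, ℝ × ℝ × ℝ) 𝓘(ℝ, E) α D p v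

/-- The curve `γ(t) = α(t, 0, 0)` of which `α` is a variation. -/
abbrev baseCurve (α : ℝ × ℝ × ℝ → M) (t : ℝ) : M := α (t, 0, 0)

variable (E) in
/-- The energy `E(α)(s₁, s₂)` of the curve `α(·, s₁, s₂)`. -/
def variationEnergy (a b : ℝ) (α : ℝ × ℝ × ℝ → M) (s₁ s₂ : ℝ) : ℝ :=
  energy E a b (fun t ↦ α (t, s₁, s₂))

/-- The vector field `α_*(v)` restricted to `s₁ = s₂ = 0`, along the base curve. The variational
vector fields `V` and `W` are obtained for `v` equal to `(0, 1, 0)` and `(0, 0, 1)`. -/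
def variationField (D : Set (ℝ × ℝ × ℝ)) (α : ℝ × ℝ × ℝ → M) (v : ℝ × ℝ × ℝ) (t : ℝ) :
    TangentSpace 𝓘(ℝ, E) (baseCurve α t) :=
  pushforward D α v (t, 0, 0)

/-- `α` is a proper variation: it fixes the end points of its base curve. -/
def IsProperVariation (a b ε₁ ε₂ : ℝ) (α : ℝ × ℝ × ℝ → M) : Prop :=
  ∀ s₁ ∈ Ioo (-ε₁) ε₁, ∀ s₂ ∈ Ioo (-ε₂) ε₂,
    α (a, s₁, s₂) = baseCurve α a ∧ α (b, s₁, s₂) = baseCurve α b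

namespace HermitianStructure

variable (h : HermitianStructure E M)

/-- The torsion `T^SB(X, Y, Z) = g(∇_X Y - ∇_Y X - [X, Y], Z)` of the Strominger–Bismut
connection. -/
def torsionSB (x : M) (X Y Z : TangentSpace 𝓘(ℝ, E) x) : ℝ :=
  inner ℝ (h.stromingerBismut.torsion x X Y) Z

/-- The curvature `R^SB(X, Y, Z, W) = g(R(X, Y)Z, W)` of the Strominger–Bismut connection. -/
def curvatureSB (x : M) (X Y Z W : TangentSpace 𝓘(ℝ, E) x) : ℝ :=
  inner ℝ (curvature h.stromingerBismut x X Y Z) W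

/-- The function
`⟨∇^SB_{d/dt} V, ∇^SB_{d/dt} W⟩ + T^SB(V, γ', ∇^SB_{d/dt} W) - R^SB(V, γ', γ', W)` on `[a, b]`, for
vector fields `V` and `W` along the curve `γ`. -/
def secondVariationIntegrand (a b : ℝ) (γ : ℝ → M) (V W : Π t : ℝ, TangentSpace 𝓘(ℝ, E) (γ t))
    (t : ℝ) : ℝ :=
  inner ℝ (covDerivAlong h.stromingerBismut γ (Icc a b) V t 1)
      (covDerivAlong h.stromingerBismut γ (Icc a b) W t 1)
    + h.torsionSB (γ t) (V t) (velocity a b γ t)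
      (covDerivAlong h.stromingerBismut γ (Icc a b) W t 1)
    - h.curvatureSB (γ t) (V t) (velocity a b γ t) (velocity a b γ t) (W t)

/-- The function `⟨∇^SB_{∂/∂s₁} α_*(∂/∂s₂), γ'⟩` at `s₁ = s₂ = 0`. -/
def boundaryTerm (a b ε₁ ε₂ : ℝ) (α : ℝ × ℝ × ℝ → M) (t : ℝ) : ℝ :=
  inner ℝ
    (covDerivAlong h.stromingerBismut α (variationDomain a b ε₁ ε₂)
      (pushforward (variationDomain a b ε₁ ε₂) α (0, 0, 1)) (t, 0, 0) (0, 1, 0))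
    (velocity (E := E) a b (baseCurve α) t)

end HermitianStructure

end Hermitian

end

/-! The proof is the classical computation of the second variation of energy, done with a connection
D that is metric and whose torsion T is a 3-form. The Strominger–Bismut connection is of this kind:
adding half of the 3-form dω(J·,J·,J·) to Levi-Civita preserves metric compatibility, because the
added term is skew in its last two slots. Being skew in its first two slots, it also leaves D_X X
unchanged, so both connections have the same geodesics.

Write x_t, V, W for the derivatives of the variation in t, s₁, s₂. As g(T(W, x_t), x_t) = 0, the
s₂-derivative of the density ½ g(x_t, x_t) is g(D_t W, x_t), with no torsion term
(`fderiv_energyDensity`). Differentiating in s₁ gives g(D_{s₁} D_t W, x_t) + g(D_t W, D_{s₁} x_t).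
In the second summand D_{s₁} x_t = D_t V + T(V, x_t). In the first, commuting the derivatives
produces g(R(V, x_t)W, x_t) = -g(R(V, x_t)x_t, W), since D is metric, and g(D_t D_{s₁} W, x_t),
which is the t-derivative of g(D_{s₁} W, x_t) because D_t x_t = 0 on the base curve. This is
`IsSkewMetricConnection.second_variation`, an identity on an open subset of a vector space.

To use it on `M`, metric, connection, torsion, curvature and derivatives along maps are expressed in
one chart. Smoothness of the Christoffel symbols comes from the Koszul formula by inverting the
metric. The pointwise identity is needed only for t in the open interval, where the domain of the
variation is a neighbourhood. Differentiation under the integral sign and the fundamental theorem of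
calculus then give the formula. When the end points are fixed, D_{s₁} W vanishes there, and so do
the boundary terms. -/

noncomputable section

set_option linter.unusedSectionVars false

namespace Hermitian

/-! ### Connections, torsion and curvature in a chart -/

section LocalCoordinates

set_option maxSynthPendingDepth 3

variable {E : Type*} [NormedAddCommGroup E] [NormedSpace ℝ E]
  [FiniteDimensional ℝ E] [CompleteSpace E]
  {M : Type*} [TopologicalSpace M] [ChartedSpace E M] [IsManifold 𝓘(ℝ, E) ∞ M]

/-- The coordinates of a tangent vector at `x` in the trivialization of `TM` at `x₀`. -/
def coords (x₀ x : M) : TangentSpace 𝓘(ℝ, E) x →L[ℝ] E :=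
  (trivializationAt E (TangentSpace 𝓘(ℝ, E)) x₀).continuousLinearMapAt ℝ x

/-- The tangent vector at `x` with given coordinates in the trivialization of `TM` at `x₀`. -/
def frame (x₀ x : M) : E →L[ℝ] TangentSpace 𝓘(ℝ, E) x :=
  (trivializationAt E (TangentSpace 𝓘(ℝ, E)) x₀).symmL ℝ x

variable {x₀ x : M}

theorem mem_baseSet (hx : x ∈ (chartAt E x₀).source) :
    x ∈ (trivializationAt E (TangentSpace 𝓘(ℝ, E) : M → Type _) x₀).baseSet := hx

@[simp]
theorem coords_frame (hx : x ∈ (chartAt E x₀).source) (w : E) :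
    coords x₀ x (frame x₀ x w) = w :=
  Trivialization.continuousLinearMapAt_symmL _ (mem_baseSet hx) w

@[simp]
theorem frame_coords (hx : x ∈ (chartAt E x₀).source) (v : TangentSpace 𝓘(ℝ, E) x) :
    frame x₀ x (coords x₀ x v) = v :=
  Trivialization.symmL_continuousLinearMapAt _ (mem_baseSet hx) v

theorem coords_injective (hx : x ∈ (chartAt E x₀).source) :
    Function.Injective (coords (E := E) x₀ x) :=
  Function.LeftInverse.injective (frame_coords hx)

theorem trivializationAt_snd (hx : x ∈ (chartAt E x₀).source) (v : TangentSpace 𝓘(ℝ, E) x) :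
    (trivializationAt E (TangentSpace 𝓘(ℝ, E)) x₀ (TotalSpace.mk' E x v)).2 = coords x₀ x v := by
  rw [coords, Trivialization.continuousLinearMapAt_apply,
    Trivialization.coe_linearMapAt_of_mem _ hx]

theorem extend_eq_frame {y : M} (hy : y ∈ (chartAt E x).source) (v : TangentSpace 𝓘(ℝ, E) x) :
    extend E v y = frame x y (coords x x v) := by
  rw [← trivializationAt_snd (mem_chart_source E x), frame, Trivialization.symmL_apply _ hy]
  rfl

/-- The trivialization of the tangent bundle at `x₀` is the differential of the chart. Through this
identity, bundle coordinates of derivatives become derivatives of coordinates. -/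
theorem coords_eq_mfderiv (hx : x ∈ (chartAt E x₀).source) :
    coords x₀ x = mfderiv 𝓘(ℝ, E) 𝓘(ℝ, E) (extChartAt 𝓘(ℝ, E) x₀) x :=
  TangentBundle.continuousLinearMapAt_trivializationAt hx

theorem mdiffAt_section_iff {X : Π x : M, TangentSpace 𝓘(ℝ, E) x}
    (hx : x ∈ (chartAt E x₀).source) :
    MDiffAt (T% X) x ↔ MDiffAt (fun y ↦ coords x₀ y (X y)) x := by
  rw [Trivialization.mdifferentiableAt_section_iff 𝓘(ℝ, E)
    (trivializationAt E (TangentSpace 𝓘(ℝ, E)) x₀) X (mem_baseSet hx)]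
  refine Filter.EventuallyEq.mdifferentiableAt_iff ?_
  filter_upwards [(chartAt E x₀).open_source.mem_nhds hx] with y hy
  exact trivializationAt_snd hy _

theorem contMDiffAt_section_iff_coords {X : Π x : M, TangentSpace 𝓘(ℝ, E) x}
    (hx : x ∈ (chartAt E x₀).source) :
    CMDiffAt ∞ (T% X) x ↔ CMDiffAt ∞ (fun y ↦ coords x₀ y (X y)) x := by
  rw [Trivialization.contMDiffAt_section_iff
    (e := trivializationAt E (TangentSpace 𝓘(ℝ, E)) x₀) (mem_baseSet hx)]
  refine Filter.EventuallyEq.contMDiffAt_iff ?_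
  filter_upwards [(chartAt E x₀).open_source.mem_nhds hx] with y hy
  exact trivializationAt_snd hy _

theorem contMDiffAt_frame (hx : x ∈ (chartAt E x₀).source) (w : E) :
    CMDiffAt ∞ (T% (fun y ↦ frame x₀ y w)) x := by
  rw [contMDiffAt_section_iff_coords hx]
  refine (contMDiffAt_const (c := w)).congr_of_eventuallyEq ?_
  filter_upwards [(chartAt E x₀).open_source.mem_nhds hx] with y hy
  exact coords_frame hy w

theorem mdiffAt_frame (hx : x ∈ (chartAt E x₀).source) (w : E) :
    MDiffAt (T% (fun y ↦ frame x₀ y w)) x :=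
  (contMDiffAt_frame hx w).mdifferentiableAt (by simp)

/-- The connection of `TM` over the chart domain at `x₀` for which the coordinate frame is
parallel. -/
def flatDerivative (x₀ : M) (X : Π x : M, TangentSpace 𝓘(ℝ, E) x) (x : M) :
    TangentSpace 𝓘(ℝ, E) x →L[ℝ] TangentSpace 𝓘(ℝ, E) x :=
  (frame x₀ x).comp (mvfderiv 𝓘(ℝ, E) (fun y ↦ coords x₀ y (X y)) x)

theorem isCovariantDerivativeOn_flatDerivative (x₀ : M) :
    IsCovariantDerivativeOn E (flatDerivative (E := E) x₀) (chartAt E x₀).source where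
  add {X Y x} hX hY hx := by
    rw [mdiffAt_section_iff hx] at hX hY
    have : (fun y ↦ coords x₀ y ((X + Y) y)) =
      (fun y ↦ coords x₀ y (X y)) + fun y ↦ coords x₀ y (Y y) := by
        ext y; simp
    rw [flatDerivative, this, mvfderiv_add hX hY]
    ext v
    simp [flatDerivative]
  leibniz {X f x} hX hf hx := by
    rw [mdiffAt_section_iff hx] at hX
    have : (fun y ↦ coords x₀ y ((f • X) y)) = f • (fun y ↦ coords x₀ y (X y)) := by
      ext y; simp
    rw [flatDerivative, this, mvfderiv_smul hf hX]
    ext v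
    simp [flatDerivative, hx]

theorem flatDerivative_frame (hx : x ∈ (chartAt E x₀).source) (w : E) :
    flatDerivative x₀ (fun y ↦ frame x₀ y w) x = 0 := by
  have : mvfderiv 𝓘(ℝ, E) (fun y ↦ coords x₀ y (frame x₀ y w)) x = 0 := by
    have h1 : (fun y ↦ coords x₀ y (frame x₀ y w)) =ᶠ[𝓝 x] fun _ ↦ w := by
      filter_upwards [(chartAt E x₀).open_source.mem_nhds hx] with y hy
      exact coords_frame hy w
    ext v
    have := mvfderiv_const (I := 𝓘(ℝ, E)) w (x := x)
    simp only [mvfderiv] at this ⊢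
    rw [h1.mfderiv_eq]
    exact congr($this v)
  rw [flatDerivative, this]
  ext v
  simp

variable (cov : CovariantDerivative 𝓘(ℝ, E) E (fun x : M ↦ TangentSpace 𝓘(ℝ, E) x))

/-- The Christoffel symbol of a connection in the chart at `x₀`, at the point of coordinates `y`:
`christoffel cov x₀ y w u` has the coordinates of `∇_u w`, where `u` and `w` are extended with
constant coefficients. -/
def christoffel (x₀ : M) (y : E) : E →L[ℝ] E →L[ℝ] E :=
  let x := (extChartAt 𝓘(ℝ, E) x₀).symm y
  let A := (cov.isCovariantDerivativeOn (s := (chartAt E x₀).source)).difference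
    (isCovariantDerivativeOn_flatDerivative x₀) x
  LinearMap.toContinuousLinearMap
    { toFun := fun w ↦ (coords x₀ x).comp ((A (frame x₀ x w)).comp (frame x₀ x))
      map_add' := fun w w' ↦ by ext; simp
      map_smul' := fun c w ↦ by ext; simp }

variable {cov} {X : Π x : M, TangentSpace 𝓘(ℝ, E) x}

/-- Two connections differ by a tensor. Taking the flat connection of the chart as reference, that
tensor is the Christoffel symbol. -/
theorem cov_eq_flatDerivative_add (hx : x ∈ (chartAt E x₀).source) (hX : MDiffAt (T% X) x)
    (v : TangentSpace 𝓘(ℝ, E) x) :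
    cov X x v = flatDerivative x₀ X x v + frame x₀ x (christoffel cov x₀ (extChartAt 𝓘(ℝ, E) x₀ x)
      (coords x₀ x (X x)) (coords x₀ x v)) := by
  have h1 := IsCovariantDerivativeOn.difference_apply
    (cov.isCovariantDerivativeOn (s := (chartAt E x₀).source))
    (isCovariantDerivativeOn_flatDerivative x₀) hx hX
  have h2 : (extChartAt 𝓘(ℝ, E) x₀).symm (extChartAt 𝓘(ℝ, E) x₀ x) = x :=
    (extChartAt 𝓘(ℝ, E) x₀).left_inv (by simpa using hx)
  -- `christoffel` lives at the point obtained by going to the chart and back, which equals `x` only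
  -- propositionally. The base point is generalized so that the equality can be substituted in the
  -- dependent fibres.
  have h3 : ∀ x', x' = x → frame x₀ x (coords x₀ x'
      ((cov.isCovariantDerivativeOn (s := (chartAt E x₀).source)).difference
        (isCovariantDerivativeOn_flatDerivative x₀) x' (frame x₀ x' (coords x₀ x (X x)))
        (frame x₀ x' (coords x₀ x v)))) = cov X x v - flatDerivative x₀ X x v := by
    rintro _ rfl
    rw [frame_coords hx, frame_coords hx, frame_coords hx, h1]
    rfl
  have h4 := h3 _ h2
  simp only [christoffel, LinearMap.coe_toContinuousLinearMap', LinearMap.coe_mk, AddHom.coe_mk,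
    ContinuousLinearMap.comp_apply]
  rw [h4]
  abel

theorem coords_cov (hx : x ∈ (chartAt E x₀).source) (hX : MDiffAt (T% X) x)
    (v : TangentSpace 𝓘(ℝ, E) x) :
    coords x₀ x (cov X x v) = mvfderiv 𝓘(ℝ, E) (fun y ↦ coords x₀ y (X y)) x v
      + christoffel cov x₀ (extChartAt 𝓘(ℝ, E) x₀ x) (coords x₀ x (X x)) (coords x₀ x v) := by
  rw [cov_eq_flatDerivative_add hx hX, map_add, coords_frame hx]
  simp [flatDerivative, hx]

theorem coords_cov_frame (hx : x ∈ (chartAt E x₀).source) (w : E) (v : TangentSpace 𝓘(ℝ, E) x) :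
    coords x₀ x (cov (fun y ↦ frame x₀ y w) x v) =
      christoffel cov x₀ (extChartAt 𝓘(ℝ, E) x₀ x) w (coords x₀ x v) := by
  rw [cov_eq_flatDerivative_add hx (mdiffAt_frame hx w), flatDerivative_frame hx]
  simp [hx]

/-- A section of `TM` near `x`, compared with the one that has constant coefficients. -/
theorem cov_eq_frame_mvfderiv_add (hx : x ∈ (chartAt E x₀).source) (hX : MDiffAt (T% X) x)
    (v : TangentSpace 𝓘(ℝ, E) x) :
    cov X x v = frame x₀ x (mvfderiv 𝓘(ℝ, E) (fun y ↦ coords x₀ y (X y)) x v)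
      + cov (fun y ↦ frame x₀ y (coords x₀ x (X x))) x v := by
  apply coords_injective hx
  rw [coords_cov hx hX, map_add, coords_frame hx, coords_cov_frame hx]

/-! ### Reading functions and vectors in the chart -/

theorem extChartAt_mem_target (hx : x ∈ (chartAt E x₀).source) :
    extChartAt 𝓘(ℝ, E) x₀ x ∈ (extChartAt 𝓘(ℝ, E) x₀).target :=
  (extChartAt 𝓘(ℝ, E) x₀).map_source (by simpa using hx)

theorem extChartAt_symm_mem {y : E} (hy : y ∈ (extChartAt 𝓘(ℝ, E) x₀).target) :
    (extChartAt 𝓘(ℝ, E) x₀).symm y ∈ (chartAt E x₀).source := by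
  simpa using (extChartAt 𝓘(ℝ, E) x₀).map_target hy

theorem extChartAt_left_inv (hx : x ∈ (chartAt E x₀).source) :
    (extChartAt 𝓘(ℝ, E) x₀).symm (extChartAt 𝓘(ℝ, E) x₀ x) = x :=
  (extChartAt 𝓘(ℝ, E) x₀).left_inv (by simpa using hx)

theorem mvfderiv_eq_fderiv_coords {F : Type*} [NormedAddCommGroup F] [NormedSpace ℝ F] {f : M → F}
    (hx : x ∈ (chartAt E x₀).source) (hf : MDiffAt f x) (v : TangentSpace 𝓘(ℝ, E) x) :
    mvfderiv 𝓘(ℝ, E) f x v = fderiv ℝ (f ∘ (extChartAt 𝓘(ℝ, E) x₀).symm)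
      (extChartAt 𝓘(ℝ, E) x₀ x) (coords x₀ x v) := by
  set c := extChartAt 𝓘(ℝ, E) x₀
  have hfc : MDifferentiableAt 𝓘(ℝ, E) 𝓘(ℝ, F) (f ∘ c.symm) (c x) := by
    refine MDifferentiableAt.comp (I' := 𝓘(ℝ, E)) (c x) (g := f) ?_ ?_
    · rw [extChartAt_left_inv hx]; exact hf
    · exact ((contMDiffOn_extChartAt_symm x₀ (n := ∞)).contMDiffAt
        ((isOpen_extChartAt_target x₀).mem_nhds (extChartAt_mem_target hx))).mdifferentiableAt
          (by simp)
  have hc : MDifferentiableAt 𝓘(ℝ, E) 𝓘(ℝ, E) c x := mdifferentiableAt_extChartAt hx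
  have h1 : f =ᶠ[𝓝 x] (f ∘ c.symm) ∘ c := by
    filter_upwards [(chartAt E x₀).open_source.mem_nhds hx] with y hy
    simp only [Function.comp_apply, c, extChartAt_left_inv hy]
  have h2 : mfderiv 𝓘(ℝ, E) 𝓘(ℝ, F) f x = (fderiv ℝ (f ∘ c.symm) (c x)).comp
      (mfderiv 𝓘(ℝ, E) 𝓘(ℝ, E) c x) := by
    rw [h1.mfderiv_eq, mfderiv_comp x hfc hc, mfderiv_eq_fderiv]
    rfl
  rw [coords_eq_mfderiv hx]
  exact congr($h2 v)

theorem mvfderiv_frame {F : Type*} [NormedAddCommGroup F] [NormedSpace ℝ F] {f : M → F}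
    (hx : x ∈ (chartAt E x₀).source) (hf : MDiffAt f x) (v : E) :
    mvfderiv 𝓘(ℝ, E) f x (frame x₀ x v) = fderiv ℝ (f ∘ (extChartAt 𝓘(ℝ, E) x₀).symm)
      (extChartAt 𝓘(ℝ, E) x₀ x) v := by
  rw [mvfderiv_eq_fderiv_coords hx hf, coords_frame hx]

theorem contDiffOn_comp_extChartAt_symm {F : Type*} [NormedAddCommGroup F] [NormedSpace ℝ F]
    {f : M → F} (hf : ∀ x ∈ (chartAt E x₀).source, CMDiffAt ∞ f x) :
    ContDiffOn ℝ ∞ (f ∘ (extChartAt 𝓘(ℝ, E) x₀).symm) (extChartAt 𝓘(ℝ, E) x₀).target := by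
  rw [← contMDiffOn_iff_contDiffOn]
  intro y hy
  exact (hf _ (extChartAt_symm_mem hy)).comp_contMDiffWithinAt y
    (contMDiffOn_extChartAt_symm x₀ (n := ∞) y hy)

/-- The constant vector field on the model space. -/
def constField (w : E) (y : E) : TangentSpace 𝓘(ℝ, E) y := w

/-- Pulling back by the chart applies the inverse of its differential, that is, the inverse of
`coords`. It brings the brackets of frame fields down to brackets of constant fields. -/
theorem frame_eq_mpullback (hx : x ∈ (chartAt E x₀).source) (w : E) :
    frame x₀ x w = mpullback 𝓘(ℝ, E) 𝓘(ℝ, E) (extChartAt 𝓘(ℝ, E) x₀) (constField w) x := by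
  have h1 : (coords (E := E) x₀ x).inverse = frame x₀ x :=
    ContinuousLinearMap.inverse_eq (by ext; simp [hx]) (by ext; simp [hx])
  rw [coords_eq_mfderiv hx] at h1
  rw [mpullback_apply]
  exact congr($h1.symm w)

theorem mdiffAt_constField (w y : E) : MDiffAt (T% (constField w)) y :=
  (contMDiffAt_vectorSpace_iff_contDiffAt (n := 1) (V := constField w)
    |>.2 (contDiffAt_const (c := w))).mdifferentiableAt (by simp)

theorem mlieBracket_constField (u w y : E) :
    mlieBracket 𝓘(ℝ, E) (constField u) (constField w) y = 0 := by
  rw [← mlieBracketWithin_univ, mlieBracketWithin_eq_lieBracketWithin]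
  have h (w : E) : fderivWithin ℝ (constField w : E → E) univ y = 0 :=
    congr($(fderivWithin_fun_const (𝕜 := ℝ) (s := (univ : Set E)) w) y)
  exact (congr($(h w) u - $(h u) w)).trans (sub_self _)

/-- Brackets commute with pull-back, and constant fields commute. Hence no bracket terms survive in
the coordinate formulas for Koszul, torsion and curvature. -/
theorem mlieBracket_frame (hx : x ∈ (chartAt E x₀).source) (u w : E) :
    mlieBracket 𝓘(ℝ, E) (fun y ↦ frame x₀ y u) (fun y ↦ frame x₀ y w) x = 0 := by
  have h1 (w : E) : (fun y ↦ frame x₀ y w) =ᶠ[𝓝 x]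
      mpullback 𝓘(ℝ, E) 𝓘(ℝ, E) (extChartAt 𝓘(ℝ, E) x₀) (constField w) := by
    filter_upwards [(chartAt E x₀).open_source.mem_nhds hx] with y hy
    exact frame_eq_mpullback hy w
  have : IsManifold 𝓘(ℝ, E) (minSmoothness ℝ 2) M := by
    rw [minSmoothness_of_isRCLikeNormedField]
    infer_instance
  rw [(h1 u).mlieBracket_vectorField_eq (h1 w), ← mpullback_mlieBracket (n := ∞)
    (mdiffAt_constField u _) (mdiffAt_constField w _) (contMDiffAt_extChartAt' hx)
    (by simpa using ENat.LEInfty.out),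
    mpullback_apply, mlieBracket_constField, map_zero]

theorem coords_torsion (hx : x ∈ (chartAt E x₀).source) (u w : TangentSpace 𝓘(ℝ, E) x) :
    coords x₀ x (cov.torsion x u w) =
      christoffel cov x₀ (extChartAt 𝓘(ℝ, E) x₀ x) (coords x₀ x w) (coords x₀ x u)
      - christoffel cov x₀ (extChartAt 𝓘(ℝ, E) x₀ x) (coords x₀ x u) (coords x₀ x w) := by
  have := cov.torsion_apply (mdiffAt_frame hx (coords x₀ x u)) (mdiffAt_frame hx (coords x₀ x w))
  simp only [frame_coords hx, mlieBracket_frame hx, sub_zero] at this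
  rw [this, map_sub, coords_cov_frame hx, coords_cov_frame hx]

theorem fderiv_apply_apply {F G H : Type*} [NormedAddCommGroup F] [NormedSpace ℝ F]
    [NormedAddCommGroup G] [NormedSpace ℝ G] [NormedAddCommGroup H] [NormedSpace ℝ H]
    {Γ : F → G →L[ℝ] G →L[ℝ] H} {y : F} (hd : DifferentiableAt ℝ Γ y) (u : F) (w v : G) :
    fderiv ℝ (fun y ↦ Γ y w v) y u = fderiv ℝ Γ y u w v := by
  have := (hd.hasFDerivAt.clm_apply (hasFDerivAt_const w y)).clm_apply (hasFDerivAt_const v y)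
  rw [this.fderiv]
  simp

/-- The coefficients of the inner derivative are the function `y ↦ Γ y w v`, so the outer one is its
derivative plus one more Christoffel term. The differentiability half is what `cov_congr` asks for
when `extend` is replaced by frame fields. -/
theorem mdiffAt_and_coords_cov_cov_frame (hx : x ∈ (chartAt E x₀).source) {y : E}
    (hy : y = extChartAt 𝓘(ℝ, E) x₀ x) (hd : DifferentiableAt ℝ (christoffel cov x₀) y)
    (w v : E) (u : TangentSpace 𝓘(ℝ, E) x) :
    MDiffAt (T% (fun z ↦ cov (fun z ↦ frame x₀ z w) z (frame x₀ z v))) x ∧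
    coords x₀ x (cov (fun z ↦ cov (fun z ↦ frame x₀ z w) z (frame x₀ z v)) x u) =
      fderiv ℝ (christoffel cov x₀) y (coords x₀ x u) w v
      + christoffel cov x₀ y (christoffel cov x₀ y w v) (coords x₀ x u) := by
  subst hy
  have h1 : (fun y ↦ coords x₀ y (cov (fun z ↦ frame x₀ z w) y (frame x₀ y v))) =ᶠ[𝓝 x]
      (fun y ↦ christoffel cov x₀ y w v) ∘ extChartAt 𝓘(ℝ, E) x₀ := by
    filter_upwards [(chartAt E x₀).open_source.mem_nhds hx] with y hy
    rw [coords_cov_frame hy, coords_frame hy, Function.comp_apply]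
  have hd2 : DifferentiableAt ℝ (fun y ↦ christoffel cov x₀ y w v) (extChartAt 𝓘(ℝ, E) x₀ x) :=
    (hd.clm_apply (differentiableAt_const _)).clm_apply (differentiableAt_const _)
  have h2 : MDiffAt ((fun y ↦ christoffel cov x₀ y w v) ∘ extChartAt 𝓘(ℝ, E) x₀) x :=
    hd2.mdifferentiableAt.comp x (mdifferentiableAt_extChartAt hx)
  have h3 : MDiffAt (fun y ↦ coords x₀ y (cov (fun z ↦ frame x₀ z w) y (frame x₀ y v))) x :=
    h2.congr_of_eventuallyEq h1
  refine ⟨(mdiffAt_section_iff hx).2 h3, ?_⟩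
  rw [coords_cov hx ((mdiffAt_section_iff hx).2 h3), coords_cov_frame hx, coords_frame hx,
    mvfderiv_eq_fderiv_coords hx h3]
  congr 1
  have h4 : ((fun y ↦ coords x₀ y (cov (fun z ↦ frame x₀ z w) y (frame x₀ y v))) ∘
      (extChartAt 𝓘(ℝ, E) x₀).symm) =ᶠ[𝓝 (extChartAt 𝓘(ℝ, E) x₀ x)]
      fun y ↦ christoffel cov x₀ y w v := by
    filter_upwards [(isOpen_extChartAt_target (I := 𝓘(ℝ, E)) x₀).mem_nhds
      (extChartAt_mem_target hx)] with y hy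
    simp only [Function.comp_apply]
    rw [coords_cov_frame (extChartAt_symm_mem hy), coords_frame (extChartAt_symm_mem hy),
      (extChartAt 𝓘(ℝ, E) x₀).right_inv hy]
  rw [h4.fderiv_eq]
  exact fderiv_apply_apply hd _ _ _

/-- Locality of a connection. Differentiability is required because the axioms constrain the
connection only on differentiable sections. -/
theorem cov_congr {Y Z : Π x : M, TangentSpace 𝓘(ℝ, E) x} {z : M} (h : Y =ᶠ[𝓝 z] Z)
    (hZ : MDiffAt (T% Z) z) : cov Y z = cov Z z := by
  have hY : MDiffAt (T% Y) z := by
    refine hZ.congr_of_eventuallyEq ?_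
    filter_upwards [h] with z hz
    rw [hz]
  exact cov.isCovariantDerivativeOnUniv.congr_of_eventuallyEq hY hZ Filter.univ_mem h

theorem extend_eventuallyEq_frame {z : M} (hz : z ∈ (chartAt E x).source)
    (u : TangentSpace 𝓘(ℝ, E) x) :
    (FiberBundle.extend E u : Π z : M, TangentSpace 𝓘(ℝ, E) z) =ᶠ[𝓝 z]
      fun z ↦ frame x z (coords x x u) := by
  filter_upwards [(chartAt E x).open_source.mem_nhds hz] with z hz
  exact extend_eq_frame hz u

/-- The standard extensions used by `curvature` are the frame fields of the chart at `x` itself.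
This is why the formula is stated in that chart, and why the bracket term drops out. -/
theorem coords_curvature {y : E} (hy : y = extChartAt 𝓘(ℝ, E) x x)
    (hd : DifferentiableAt ℝ (christoffel cov x) y) (u v w : TangentSpace 𝓘(ℝ, E) x)
    {u' v' w' : E} (hu : coords x x u = u') (hv : coords x x v = v') (hw : coords x x w = w') :
    coords x x (curvature cov x u v w) =
      fderiv ℝ (christoffel cov x) y u' w' v' - fderiv ℝ (christoffel cov x) y v' w' u'
      + christoffel cov x y (christoffel cov x y w' v') u'
      - christoffel cov x y (christoffel cov x y w' u') v' := by
  have hx := mem_chart_source E x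
  have hU := (chartAt E x).open_source.mem_nhds hx
  have ev (u : TangentSpace 𝓘(ℝ, E) x) {z : M} (hz : z ∈ (chartAt E x).source) :
      (FiberBundle.extend E u : Π z : M, TangentSpace 𝓘(ℝ, E) z) =ᶠ[𝓝 z]
        fun z ↦ frame x z (coords x x u) := extend_eventuallyEq_frame hz u
  have h1 (v u : TangentSpace 𝓘(ℝ, E) x) :
      coords x x (cov (fun y ↦ cov (extend E w) y (extend E v y)) x u) =
      fderiv ℝ (christoffel cov x) y (coords x x u) (coords x x w) (coords x x v)
      + christoffel cov x y (christoffel cov x y (coords x x w) (coords x x v)) (coords x x u) := by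
    obtain ⟨k1, k2⟩ := mdiffAt_and_coords_cov_cov_frame hx hy hd (coords x x w) (coords x x v) u
    have : (fun y ↦ cov (extend E w) y (extend E v y)) =ᶠ[𝓝 x]
        fun z ↦ cov (fun z ↦ frame x z (coords x x w)) z (frame x z (coords x x v)) := by
      filter_upwards [hU] with z hz
      rw [extend_eq_frame hz, cov_congr (ev w hz) (mdiffAt_frame hz _)]
    rw [cov_congr this k1, k2]
  subst hu hv hw
  rw [curvature, (ev u hx).mlieBracket_vectorField_eq (ev v hx), mlieBracket_frame hx, map_zero,
    sub_zero, map_sub, h1, h1]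
  abel

/-- The connection along a map, in the coordinates of the chart at `x₀`. -/
theorem coords_covDerivAlong {P : Type*} [NormedAddCommGroup P] [NormedSpace ℝ P] {f : P → M}
    {S : Set P} {V : Π p : P, TangentSpace 𝓘(ℝ, E) (f p)} {p : P}
    (hx : f p ∈ (chartAt E x₀).source) (hp : p ∈ S) (hS : UniqueDiffWithinAt ℝ S p)
    (hf : MDiffAt[S] f p) (hV : DifferentiableWithinAt ℝ (fun q ↦ coords x₀ (f q) (V q)) S p)
    (v : P) :
    coords x₀ (f p) (covDerivAlong cov f S V p v) =
      fderivWithin ℝ (fun q ↦ coords x₀ (f q) (V q)) S p v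
      + christoffel cov x₀ (extChartAt 𝓘(ℝ, E) x₀ (f p)) (coords x₀ (f p) (V p))
        (coords x₀ (f p) (mfderivWithin 𝓘(ℝ, P) 𝓘(ℝ, E) f S p v)) := by
  have hp' := mem_chart_source E (f p)
  have hc := hf.continuousWithinAt
  -- `covDerivAlong` is defined in the trivialization at `f p`, which moves with `p`, so `A` passes
  -- from the frame at `x₀` to that one. Its derivative arises twice: in the product rule for the
  -- coefficients of `V` (`h3`), and in the covariant derivative of a frame field of `x₀` (`h4`,
  -- `h5`). Matching the two occurrences gives independence of the frame.
  set A : M → E →L[ℝ] E := fun x ↦ (Trivialization.coordChangeL ℝ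
    (trivializationAt E (TangentSpace 𝓘(ℝ, E)) x₀)
    (trivializationAt E (TangentSpace 𝓘(ℝ, E)) (f p)) x : E →L[ℝ] E) with hA
  have hAe {x : M} (h0 : x ∈ (chartAt E x₀).source) (h1 : x ∈ (chartAt E (f p)).source) (w : E) :
      A x w = coords (f p) x (frame x₀ x w) := by
    rw [← trivializationAt_snd h1, frame, Trivialization.symmL_apply _ (mem_baseSet h0), hA]
    exact Trivialization.coordChangeL_apply _ _ ⟨mem_baseSet h0, mem_baseSet h1⟩ w
  have hAd : MDiffAt A (f p) :=
    ((contMDiffOn_coordChangeL (n := ∞) (IB := 𝓘(ℝ, E))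
      (trivializationAt E (TangentSpace 𝓘(ℝ, E)) x₀)
      (trivializationAt E (TangentSpace 𝓘(ℝ, E)) (f p))).contMDiffAt
      (((chartAt E x₀).open_source.inter (chartAt E (f p)).open_source).mem_nhds
        ⟨hx, hp'⟩)).mdifferentiableAt (by simp)
  set w := coords x₀ (f p) (V p) with hw
  set u := mfderivWithin 𝓘(ℝ, P) 𝓘(ℝ, E) f S p v with hu
  -- the coordinates of `V` at nearby points
  have h1 : (fun q ↦ (trivializationAt E (fun x : M ↦ TangentSpace 𝓘(ℝ, E) x) (f p)
        (TotalSpace.mk' E (f q) (V q))).2) =ᶠ[𝓝[S] p]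
      fun q ↦ A (f q) (coords x₀ (f q) (V q)) := by
    filter_upwards [hc ((chartAt E x₀).open_source.mem_nhds hx),
      hc ((chartAt E (f p)).open_source.mem_nhds hp')] with q hq hq'
    rw [hAe hq hq', frame_coords hq]
    exact trivializationAt_snd hq' _
  have hAf : DifferentiableWithinAt ℝ (fun q ↦ A (f q)) S p := by
    rw [← mdifferentiableWithinAt_iff_differentiableWithinAt]
    exact hAd.comp_mdifferentiableWithinAt p hf
  have h2 : fderivWithin ℝ (fun q ↦ A (f q)) S p v = mvfderiv 𝓘(ℝ, E) A (f p) u := by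
    have := mfderiv_comp_mfderivWithin (I := 𝓘(ℝ, P)) (I' := 𝓘(ℝ, E)) (I'' := 𝓘(ℝ, E →L[ℝ] E))
      p hAd hf hS.uniqueMDiffWithinAt
    rw [mfderivWithin_eq_fderivWithin] at this
    exact congr($this v)
  have h3 : fderivWithin ℝ (fun q ↦ (trivializationAt E (fun x : M ↦ TangentSpace 𝓘(ℝ, E) x) (f p)
        (TotalSpace.mk' E (f q) (V q))).2) S p v =
      A (f p) (fderivWithin ℝ (fun q ↦ coords x₀ (f q) (V q)) S p v)
        + mvfderiv 𝓘(ℝ, E) A (f p) u w := by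
    rw [h1.fderivWithin_eq_of_mem hp, fderivWithin_clm_apply hS hAf hV, ← h2]
    rfl
  -- the frame at `x₀` in the coordinates at `f p`
  have h4 : mvfderiv 𝓘(ℝ, E) (fun x ↦ coords (f p) x (frame x₀ x w)) (f p) u =
      mvfderiv 𝓘(ℝ, E) A (f p) u w := by
    have e1 : (fun x ↦ coords (f p) x (frame x₀ x w)) =ᶠ[𝓝 (f p)]
        ContinuousLinearMap.apply ℝ E w ∘ A := by
      filter_upwards [(chartAt E x₀).open_source.mem_nhds hx,
        (chartAt E (f p)).open_source.mem_nhds hp'] with q hq hq'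
      exact (hAe hq hq' w).symm
    have e2 := ((ContinuousLinearMap.apply ℝ E w).hasMFDerivAt (x := A (f p))).comp (f p)
      hAd.hasMFDerivAt
    exact congr($((e2.congr_of_eventuallyEq e1).mfderiv) u)
  have h5 := cov_eq_frame_mvfderiv_add (cov := cov) hp' (mdiffAt_frame hx w) u
  have h6 : frame x₀ (f p) w = V p := frame_coords hx _
  have h7 : (trivializationAt E (fun x : M ↦ TangentSpace 𝓘(ℝ, E) x) (f p)).symm (f p) =
      frame (f p) (f p) := by
    ext z
    exact (Trivialization.symmL_apply _ hp' z).symm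
  have h8 : covDerivAlong cov f S V p v =
      frame x₀ (f p) (fderivWithin ℝ (fun q ↦ coords x₀ (f q) (V q)) S p v)
        + cov (fun y ↦ frame x₀ y w) (f p) u := by
    rw [h5, h4, h6, covDerivAlong, h3, h7, map_add, hAe hx hp', frame_coords hp',
      cov_congr (extend_eventuallyEq_frame hp' (V p)) (mdiffAt_frame hp' _), add_assoc]
  rw [h8, map_add, coords_frame hx, coords_cov_frame hx]

end LocalCoordinates

/-! ### The metric and the two connections in a chart -/

section MetricCoordinates

set_option maxSynthPendingDepth 3

theorem contDiffOn_fderiv_apply_apply {F G H : Type*} [NormedAddCommGroup F] [NormedSpace ℝ F]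
    [NormedAddCommGroup G] [NormedSpace ℝ G] [NormedAddCommGroup H] [NormedSpace ℝ H]
    {Γ : F → G →L[ℝ] G →L[ℝ] H} {s : Set F} (hΓ : ContDiffOn ℝ ∞ Γ s) (hs : IsOpen s)
    (u : F) (v w : G) : ContDiffOn ℝ ∞ (fun y ↦ fderiv ℝ Γ y u v w) s := by
  have h₀ : ContDiffOn ℝ ∞ (fderiv ℝ Γ) s := hΓ.fderiv_of_isOpen hs (m := ∞) (by simp)
  have h₁ : ContDiffOn ℝ ∞ (fun y ↦ fderiv ℝ Γ y u) s := h₀.clm_apply contDiffOn_const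
  have h₂ : ContDiffOn ℝ ∞ (fun y ↦ fderiv ℝ Γ y u v) s := h₁.clm_apply contDiffOn_const
  exact h₂.clm_apply contDiffOn_const

variable {E : Type*} [NormedAddCommGroup E] [NormedSpace ℝ E]
  [FiniteDimensional ℝ E] [CompleteSpace E]
  {M : Type*} [TopologicalSpace M] [ChartedSpace E M] [IsManifold 𝓘(ℝ, E) ∞ M]
  [RiemannianBundle (fun x : M ↦ TangentSpace 𝓘(ℝ, E) x)]

/-- The metric in the chart at `x₀`, at the point of coordinates `y`. -/
def metricCoords (x₀ : M) (y : E) : E →L[ℝ] E →L[ℝ] ℝ :=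
  let x := (extChartAt 𝓘(ℝ, E) x₀).symm y
  LinearMap.toContinuousLinearMap
    { toFun := fun v ↦ (innerSL ℝ (frame x₀ x v)).comp (frame x₀ x)
      map_add' := fun v w ↦ by ext; simp
      map_smul' := fun c v ↦ by ext; simp }

variable {x₀ x : M} {y : E}

theorem metricCoords_apply (x₀ : M) (y v w : E) :
    metricCoords x₀ y v w = inner ℝ (frame x₀ ((extChartAt 𝓘(ℝ, E) x₀).symm y) v)
      (frame x₀ ((extChartAt 𝓘(ℝ, E) x₀).symm y) w) := rfl

theorem inner_frame (hx : x ∈ (chartAt E x₀).source) (v w : E) :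
    inner ℝ (frame x₀ x v) (frame x₀ x w) =
      metricCoords x₀ (extChartAt 𝓘(ℝ, E) x₀ x) v w := by
  rw [metricCoords_apply, extChartAt_left_inv hx]

theorem inner_eq_metricCoords (hx : x ∈ (chartAt E x₀).source) (v w : TangentSpace 𝓘(ℝ, E) x) :
    inner ℝ v w = metricCoords x₀ (extChartAt 𝓘(ℝ, E) x₀ x) (coords x₀ x v) (coords x₀ x w) := by
  rw [← inner_frame hx, frame_coords hx, frame_coords hx]

theorem metricCoords_symm (x₀ : M) (y v w : E) : metricCoords x₀ y v w = metricCoords x₀ y w v := by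
  rw [metricCoords_apply, metricCoords_apply, real_inner_comm]

theorem eq_zero_of_metricCoords (hy : y ∈ (extChartAt 𝓘(ℝ, E) x₀).target) {v : E}
    (hv : ∀ w, metricCoords x₀ y v w = 0) : v = 0 := by
  have h1 := hv v
  rw [metricCoords_apply, inner_self_eq_zero] at h1
  rw [← coords_frame (extChartAt_symm_mem hy) v, h1, map_zero]

theorem isInvertible_metricCoords (hy : y ∈ (extChartAt 𝓘(ℝ, E) x₀).target) :
    (metricCoords x₀ y).IsInvertible := by
  have hinj : Function.Injective (metricCoords x₀ y : E →ₗ[ℝ] (E →L[ℝ] ℝ)) := by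
    rw [← LinearMap.ker_eq_bot, LinearMap.ker_eq_bot']
    intro v hv
    exact eq_zero_of_metricCoords hy fun w ↦ congr($hv w)
  have hdim : Module.finrank ℝ E = Module.finrank ℝ (E →L[ℝ] ℝ) := by
    rw [← (LinearMap.toContinuousLinearMap (𝕜 := ℝ) (E := E) (F' := ℝ)).finrank_eq]
    exact Subspace.dual_finrank_eq.symm
  refine ⟨(LinearEquiv.ofInjectiveOfFinrankEq _ hinj hdim).toContinuousLinearEquiv, ?_⟩
  ext v w
  rfl

variable [IsContMDiffRiemannianBundle 𝓘(ℝ, E) ∞ E (fun x : M ↦ TangentSpace 𝓘(ℝ, E) x)]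

theorem contMDiffAt_inner {X Y : Π x : M, TangentSpace 𝓘(ℝ, E) x}
    (hX : CMDiffAt ∞ (T% X) x) (hY : CMDiffAt ∞ (T% Y) x) :
    CMDiffAt ∞ (fun y ↦ inner ℝ (X y) (Y y)) x :=
  ContMDiffAt.inner_bundle (IB := 𝓘(ℝ, E)) (F := E)
    (E := fun x : M ↦ TangentSpace 𝓘(ℝ, E) x) hX hY

theorem contDiffOn_metricCoords (x₀ : M) :
    ContDiffOn ℝ ∞ (metricCoords x₀) (extChartAt 𝓘(ℝ, E) x₀).target := by
  rw [contDiffOn_clm_apply]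
  intro v
  rw [contDiffOn_clm_apply]
  intro w
  exact contDiffOn_comp_extChartAt_symm (f := fun x ↦ inner ℝ (frame x₀ x v) (frame x₀ x w))
    fun x hx ↦ contMDiffAt_inner (contMDiffAt_frame hx v) (contMDiffAt_frame hx w)

/-- Raising an index is smooth: `F` is recovered from the covector `g(F, ·)` by the inverse of the
metric, and inversion is smooth at invertible maps. Christoffel symbols are known only through such
covectors. -/
theorem contDiffOn_of_metricCoords {F : E → E} (hF : ∀ w, ContDiffOn ℝ ∞
      (fun y ↦ metricCoords x₀ y (F y) w) (extChartAt 𝓘(ℝ, E) x₀).target) :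
    ContDiffOn ℝ ∞ F (extChartAt 𝓘(ℝ, E) x₀).target := by
  have h1 : ContDiffOn ℝ ∞ (fun y ↦ metricCoords x₀ y (F y)) (extChartAt 𝓘(ℝ, E) x₀).target :=
    contDiffOn_clm_apply.2 hF
  have h2 : ContDiffOn ℝ ∞ (fun y ↦ (metricCoords x₀ y).inverse (metricCoords x₀ y (F y)))
      (extChartAt 𝓘(ℝ, E) x₀).target := by
    intro y hy
    exact ((isInvertible_metricCoords hy).contDiffAt_map_inverse.comp_contDiffWithinAt y
      (contDiffOn_metricCoords x₀ y hy)).clm_apply (h1 y hy)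
  refine h2.congr fun y hy ↦ ?_
  exact ((isInvertible_metricCoords hy).inverse_apply_eq.2 rfl).symm

/-! ### The Levi-Civita connection in coordinates -/

theorem inner_leviCivita {X Y Z : Π x : M, TangentSpace 𝓘(ℝ, E) x} (hX : MDiffAt (T% X) x)
    (hY : MDiffAt (T% Y) x) (hZ : MDiffAt (T% Z) x) :
    inner ℝ (leviCivita Y x (X x)) (Z x) = koszul X Y Z x := by
  simp only [leviCivita]
  rw [dif_pos hY, ContinuousLinearMap.comp_apply, inner_sharp]
  exact TensorialAt.mkHom₂_apply _ _ hX hZ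

theorem fderiv_metricCoords (hx : x ∈ (chartAt E x₀).source) (u v w : E) :
    mvfderiv 𝓘(ℝ, E) (fun y ↦ inner ℝ (frame x₀ y v) (frame x₀ y w)) x (frame x₀ x u) =
      fderiv ℝ (metricCoords x₀) (extChartAt 𝓘(ℝ, E) x₀ x) u v w := by
  rw [mvfderiv_frame hx (mdiffAt_inner (mdiffAt_frame hx v) (mdiffAt_frame hx w))]
  exact fderiv_apply_apply (((contDiffOn_metricCoords x₀).contDiffAt
    ((isOpen_extChartAt_target x₀).mem_nhds (extChartAt_mem_target hx))).differentiableAt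
    (by simp)) u v w

theorem koszul_frame (hx : x ∈ (chartAt E x₀).source) (u v w : E) :
    koszul (fun y ↦ frame x₀ y u) (fun y ↦ frame x₀ y v) (fun y ↦ frame x₀ y w) x =
      (1 / 2 : ℝ) * (fderiv ℝ (metricCoords x₀) (extChartAt 𝓘(ℝ, E) x₀ x) u v w
        + fderiv ℝ (metricCoords x₀) (extChartAt 𝓘(ℝ, E) x₀ x) v u w
        - fderiv ℝ (metricCoords x₀) (extChartAt 𝓘(ℝ, E) x₀ x) w u v) := by
  simp only [koszul, fderiv_metricCoords hx, mlieBracket_frame hx, inner_zero_left]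
  ring

theorem metricCoords_christoffel {cov : CovariantDerivative 𝓘(ℝ, E) E
      (fun x : M ↦ TangentSpace 𝓘(ℝ, E) x)} (hx : x ∈ (chartAt E x₀).source) (u v w : E) :
    metricCoords x₀ (extChartAt 𝓘(ℝ, E) x₀ x)
      (christoffel cov x₀ (extChartAt 𝓘(ℝ, E) x₀ x) v u) w =
    inner ℝ (cov (fun y ↦ frame x₀ y v) x (frame x₀ x u)) (frame x₀ x w) := by
  rw [inner_eq_metricCoords hx, coords_cov_frame hx, coords_frame hx, coords_frame hx]

theorem metricCoords_christoffel_leviCivita (hx : x ∈ (chartAt E x₀).source) (u v w : E) :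
    metricCoords x₀ (extChartAt 𝓘(ℝ, E) x₀ x)
      (christoffel leviCivita x₀ (extChartAt 𝓘(ℝ, E) x₀ x) v u) w =
      (1 / 2 : ℝ) * (fderiv ℝ (metricCoords x₀) (extChartAt 𝓘(ℝ, E) x₀ x) u v w
        + fderiv ℝ (metricCoords x₀) (extChartAt 𝓘(ℝ, E) x₀ x) v u w
        - fderiv ℝ (metricCoords x₀) (extChartAt 𝓘(ℝ, E) x₀ x) w u v) := by
  rw [metricCoords_christoffel hx, ← koszul_frame hx]
  exact inner_leviCivita (mdiffAt_frame hx u) (mdiffAt_frame hx v) (mdiffAt_frame hx w)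

/-! ### The Strominger–Bismut connection in coordinates -/

namespace HermitianStructure

variable (h : HermitianStructure E M)

theorem inner_stromingerBismut (Y : Π x : M, TangentSpace 𝓘(ℝ, E) x)
    (v w : TangentSpace 𝓘(ℝ, E) x) :
    inner ℝ (h.stromingerBismut Y x v) w = inner ℝ (leviCivita Y x v) w
      + (1 / 2 : ℝ) * h.extDerivOmega x (h.J x v) (h.J x (Y x)) (h.J x w) := by
  rw [← inner_bismutVector, ← inner_add_left]
  rfl

/-- The 3-form `(u, v, w) ↦ dω(Ju, Jv, Jw)` in the chart at `x₀`. -/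
def torsionCoords (x₀ : M) (y u v w : E) : ℝ :=
  let x := (extChartAt 𝓘(ℝ, E) x₀).symm y
  h.extDerivOmega x (h.J x (frame x₀ x u)) (h.J x (frame x₀ x v)) (h.J x (frame x₀ x w))

theorem torsionCoords_swap₁₂ (x₀ : M) (y u v w : E) :
    h.torsionCoords x₀ y u v w = -h.torsionCoords x₀ y v u w := extDerivOmega_swap₁₂ _ _ _

theorem torsionCoords_swap₂₃ (x₀ : M) (y u v w : E) :
    h.torsionCoords x₀ y u v w = -h.torsionCoords x₀ y u w v := extDerivOmega_swap₂₃ _ _ _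

/-- Koszul's formula for commuting frame fields plus the defining 3-form term. Smoothness, metric
compatibility and skewness of the torsion are all read off from it. -/
theorem metricCoords_christoffel_stromingerBismut (hy : y ∈ (extChartAt 𝓘(ℝ, E) x₀).target)
    (u v w : E) :
    metricCoords x₀ y (christoffel h.stromingerBismut x₀ y v u) w =
      (1 / 2 : ℝ) * (fderiv ℝ (metricCoords x₀) y u v w + fderiv ℝ (metricCoords x₀) y v u w
        - fderiv ℝ (metricCoords x₀) y w u v) + (1 / 2 : ℝ) * h.torsionCoords x₀ y u v w := by
  have hx := extChartAt_symm_mem hy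
  obtain ⟨x, rfl⟩ : ∃ x, x = (extChartAt 𝓘(ℝ, E) x₀).symm y := ⟨_, rfl⟩
  have hy' := (extChartAt 𝓘(ℝ, E) x₀).right_inv hy
  have h1 := metricCoords_christoffel (cov := h.stromingerBismut) hx u v w
  have h2 := metricCoords_christoffel_leviCivita hx u v w
  rw [metricCoords_christoffel hx] at h2
  rw [inner_stromingerBismut, h2, hy'] at h1
  exact h1

theorem contMDiffAt_J {X : Π x : M, TangentSpace 𝓘(ℝ, E) x} (hX : CMDiffAt ∞ (T% X) x) :
    CMDiffAt ∞ (T% (fun y ↦ h.J y (X y))) x :=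
  ContMDiffAt.clm_bundle_apply (F₁ := E) (F₂ := E)
    (E₁ := fun x : M ↦ TangentSpace 𝓘(ℝ, E) x) (E₂ := fun x : M ↦ TangentSpace 𝓘(ℝ, E) x)
    h.contMDiff_J.contMDiffAt hX

theorem contMDiffAt_omega {X Y : Π x : M, TangentSpace 𝓘(ℝ, E) x} (hX : CMDiffAt ∞ (T% X) x)
    (hY : CMDiffAt ∞ (T% Y) x) : CMDiffAt ∞ (fun y ↦ h.omega y (X y) (Y y)) x :=
  contMDiffAt_inner (h.contMDiffAt_J hX) hY

theorem contDiffOn_mvfderiv {f : M → ℝ} {X : Π x : M, TangentSpace 𝓘(ℝ, E) x}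
    (hf : ∀ x ∈ (chartAt E x₀).source, CMDiffAt ∞ f x)
    (hX : ∀ x ∈ (chartAt E x₀).source, CMDiffAt ∞ (T% X) x) :
    ContDiffOn ℝ ∞ ((fun x ↦ mvfderiv 𝓘(ℝ, E) f x (X x)) ∘ (extChartAt 𝓘(ℝ, E) x₀).symm)
      (extChartAt 𝓘(ℝ, E) x₀).target := by
  have h1 := contDiffOn_comp_extChartAt_symm hf
  have h2 := contDiffOn_comp_extChartAt_symm (f := fun x ↦ coords x₀ x (X x))
    fun x hx ↦ (contMDiffAt_section_iff_coords hx).1 (hX x hx)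
  have h3 := (h1.fderiv_of_isOpen (isOpen_extChartAt_target x₀) (m := ∞) (by simp)).clm_apply h2
  refine h3.congr fun y hy ↦ ?_
  have hx := extChartAt_symm_mem hy
  have h4 := mvfderiv_eq_fderiv_coords hx ((hf _ hx).mdifferentiableAt (by simp)) (X _)
  rw [(extChartAt 𝓘(ℝ, E) x₀).right_inv hy] at h4
  exact h4

theorem contMDiffAt_mlieBracket {X Y : Π x : M, TangentSpace 𝓘(ℝ, E) x}
    (hX : CMDiffAt ∞ (T% X) x) (hY : CMDiffAt ∞ (T% Y) x) :
    CMDiffAt ∞ (T% (mlieBracket 𝓘(ℝ, E) X Y)) x := by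
  have : IsManifold 𝓘(ℝ, E) (((⊤ : ℕ∞) : WithTop ℕ∞) + 1) M := by
    simpa using ‹IsManifold 𝓘(ℝ, E) ∞ M›
  have : IsManifold 𝓘(ℝ, E) (minSmoothness ℝ 2) M := by
    rw [minSmoothness_of_isRCLikeNormedField]
    infer_instance
  exact ContMDiffAt.mlieBracket_vectorField (m := ⊤) (n := ⊤) hX hY (by simp)

theorem contDiffOn_extDerivOmegaAux {X Y Z : Π x : M, TangentSpace 𝓘(ℝ, E) x}
    (hX : ∀ x ∈ (chartAt E x₀).source, CMDiffAt ∞ (T% X) x)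
    (hY : ∀ x ∈ (chartAt E x₀).source, CMDiffAt ∞ (T% Y) x)
    (hZ : ∀ x ∈ (chartAt E x₀).source, CMDiffAt ∞ (T% Z) x) :
    ContDiffOn ℝ ∞ ((fun x ↦ h.extDerivOmegaAux X Y Z x) ∘ (extChartAt 𝓘(ℝ, E) x₀).symm)
      (extChartAt 𝓘(ℝ, E) x₀).target := by
  have h1 {X Y Z : Π x : M, TangentSpace 𝓘(ℝ, E) x}
      (hX : ∀ x ∈ (chartAt E x₀).source, CMDiffAt ∞ (T% X) x)
      (hY : ∀ x ∈ (chartAt E x₀).source, CMDiffAt ∞ (T% Y) x)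
      (hZ : ∀ x ∈ (chartAt E x₀).source, CMDiffAt ∞ (T% Z) x) :=
    contDiffOn_mvfderiv (x₀ := x₀) (f := fun y ↦ h.omega y (Y y) (Z y))
      (fun x hx ↦ h.contMDiffAt_omega (hY x hx) (hZ x hx)) hX
  have h2 {X Y Z : Π x : M, TangentSpace 𝓘(ℝ, E) x}
      (hX : ∀ x ∈ (chartAt E x₀).source, CMDiffAt ∞ (T% X) x)
      (hY : ∀ x ∈ (chartAt E x₀).source, CMDiffAt ∞ (T% Y) x)
      (hZ : ∀ x ∈ (chartAt E x₀).source, CMDiffAt ∞ (T% Z) x) :=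
    contDiffOn_comp_extChartAt_symm (x₀ := x₀)
      (f := fun y ↦ h.omega y (mlieBracket 𝓘(ℝ, E) X Y y) (Z y))
      (fun x hx ↦ h.contMDiffAt_omega (contMDiffAt_mlieBracket (hX x hx) (hY x hx)) (hZ x hx))
  exact (((((h1 hX hY hZ).sub (h1 hY hX hZ)).add (h1 hZ hX hY)).sub (h2 hX hY hZ)).add
    (h2 hX hZ hY)).sub (h2 hY hZ hX)

/-- By tensoriality the extensions may be exchanged one slot at a time. The standard extensions
change with `x`, so smoothness in `x` is seen only with fields fixed on the whole chart domain. -/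
theorem extDerivOmega_eq {X Y Z : Π x : M, TangentSpace 𝓘(ℝ, E) x} (hX : MDiffAt (T% X) x)
    (hY : MDiffAt (T% Y) x) (hZ : MDiffAt (T% Z) x) :
    h.extDerivOmega x (X x) (Y x) (Z x) = h.extDerivOmegaAux X Y Z x := by
  have hX' := mdifferentiableAt_extend 𝓘(ℝ, E) E (X x)
  have hY' := mdifferentiableAt_extend 𝓘(ℝ, E) E (Y x)
  have hZ' := mdifferentiableAt_extend 𝓘(ℝ, E) E (Z x)
  have e₁ := (extDerivOmegaAux_tensorial₁ (h := h) hY' hZ').pointwise hX' hX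
    (extend_apply_self E (X x))
  have e₂ := (extDerivOmegaAux_tensorial₂ (h := h) hX hZ').pointwise hY' hY
    (extend_apply_self E (Y x))
  have e₃ := (extDerivOmegaAux_tensorial₃ (h := h) hX hY).pointwise hZ' hZ
    (extend_apply_self E (Z x))
  exact e₁.trans (e₂.trans e₃)

theorem contDiffOn_torsionCoords (x₀ : M) (u v w : E) :
    ContDiffOn ℝ ∞ (fun y ↦ h.torsionCoords x₀ y u v w) (extChartAt 𝓘(ℝ, E) x₀).target := by
  let X (u : E) (y : M) : TangentSpace 𝓘(ℝ, E) y := h.J y (frame x₀ y u)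
  have hX (u : E) (x : M) (hx : x ∈ (chartAt E x₀).source) : CMDiffAt ∞ (T% (X u)) x :=
    h.contMDiffAt_J (contMDiffAt_frame hx u)
  have hX' (u : E) (x : M) (hx : x ∈ (chartAt E x₀).source) : MDiffAt (T% (X u)) x :=
    (hX u x hx).mdifferentiableAt (by simp)
  have key (x : M) (hx : x ∈ (chartAt E x₀).source) :
      h.extDerivOmega x (X u x) (X v x) (X w x) = h.extDerivOmegaAux (X u) (X v) (X w) x :=
    h.extDerivOmega_eq (hX' u x hx) (hX' v x hx) (hX' w x hx)
  exact (h.contDiffOn_extDerivOmegaAux (hX u) (hX v) (hX w)).congr fun y hy ↦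
    key _ (extChartAt_symm_mem hy)

theorem contDiffOn_christoffel_stromingerBismut (x₀ : M) :
    ContDiffOn ℝ ∞ (christoffel h.stromingerBismut x₀) (extChartAt 𝓘(ℝ, E) x₀).target := by
  rw [contDiffOn_clm_apply]
  intro v
  rw [contDiffOn_clm_apply]
  intro u
  refine contDiffOn_of_metricCoords (x₀ := x₀) fun w ↦ ?_
  have h2 (u v w : E) : ContDiffOn ℝ ∞ (fun y ↦ fderiv ℝ (metricCoords x₀) y u v w)
      (extChartAt 𝓘(ℝ, E) x₀).target :=
    contDiffOn_fderiv_apply_apply (contDiffOn_metricCoords x₀) (isOpen_extChartAt_target x₀) u v w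
  exact ((contDiffOn_const.mul (((h2 u v w).add (h2 v u w)).sub (h2 w u v))).add
    (contDiffOn_const.mul (h.contDiffOn_torsionCoords x₀ u v w))).congr fun y hy ↦
      h.metricCoords_christoffel_stromingerBismut hy u v w

theorem fderiv_metricCoords_symm (hy : y ∈ (extChartAt 𝓘(ℝ, E) x₀).target) (u v w : E) :
    fderiv ℝ (metricCoords x₀) y u v w = fderiv ℝ (metricCoords x₀) y u w v := by
  have hd : DifferentiableAt ℝ (metricCoords x₀) y := ((contDiffOn_metricCoords x₀).contDiffAt
    ((isOpen_extChartAt_target x₀).mem_nhds hy)).differentiableAt (by simp)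
  rw [← fderiv_apply_apply hd, ← fderiv_apply_apply hd]
  simp only [metricCoords_symm x₀ _ v w]

/-- Metric compatibility. In the sum of the two Koszul expressions all derivatives of the metric but
one cancel, and the two values of the 3-form are opposite. -/
theorem fderiv_metricCoords_eq (hy : y ∈ (extChartAt 𝓘(ℝ, E) x₀).target) (u v w : E) :
    fderiv ℝ (metricCoords x₀) y u v w =
      metricCoords x₀ y (christoffel h.stromingerBismut x₀ y v u) w
      + metricCoords x₀ y v (christoffel h.stromingerBismut x₀ y w u) := by
  rw [metricCoords_symm x₀ y v, h.metricCoords_christoffel_stromingerBismut hy,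
    h.metricCoords_christoffel_stromingerBismut hy, h.torsionCoords_swap₂₃ x₀ y u w v,
    fderiv_metricCoords_symm hy u w v, fderiv_metricCoords_symm hy v u w,
    fderiv_metricCoords_symm hy w u v]
  ring

/-- This is g(T(u, v), v) = 0, as a 3-form vanishes on a repeated argument. -/
theorem metricCoords_torsion_self (hy : y ∈ (extChartAt 𝓘(ℝ, E) x₀).target) (u v : E) :
    metricCoords x₀ y (christoffel h.stromingerBismut x₀ y v u) v =
      metricCoords x₀ y (christoffel h.stromingerBismut x₀ y u v) v := by
  rw [h.metricCoords_christoffel_stromingerBismut hy,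
    h.metricCoords_christoffel_stromingerBismut hy]
  have h1 := h.torsionCoords_swap₂₃ x₀ y u v v
  have h2 := h.torsionCoords_swap₁₂ x₀ y u v v
  rw [fderiv_metricCoords_symm hy v u v]
  linarith

/-- A 3-form contributes nothing on the diagonal. Hence the geodesic equations of the two
connections coincide. -/
theorem christoffel_stromingerBismut_self (hx : x ∈ (chartAt E x₀).source) (v : E) :
    christoffel h.stromingerBismut x₀ (extChartAt 𝓘(ℝ, E) x₀ x) v v =
      christoffel leviCivita x₀ (extChartAt 𝓘(ℝ, E) x₀ x) v v := by
  have hy := extChartAt_mem_target hx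
  rw [← sub_eq_zero]
  refine eq_zero_of_metricCoords hy fun w ↦ ?_
  have h2 := h.torsionCoords_swap₁₂ x₀ (extChartAt 𝓘(ℝ, E) x₀ x) v v w
  rw [map_sub, sub_apply, h.metricCoords_christoffel_stromingerBismut hy,
    metricCoords_christoffel_leviCivita hx]
  linarith

end HermitianStructure

end MetricCoordinates

/-! ### Second variation for a metric connection with skew torsion on a vector space -/

section SecondVariationCalculus

set_option maxSynthPendingDepth 3

variable {E P : Type*} [NormedAddCommGroup E] [NormedSpace ℝ E] [NormedAddCommGroup P]
  [NormedSpace ℝ P]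

/-- A smooth metric `g` and a smooth connection with Christoffel symbol `Γ` on an open subset of
a vector space, such that the connection is metric and its torsion is totally skew-symmetric.
The vector `Γ y w u` is `∇_u w` at `y`, where `w` is constant. -/
structure IsSkewMetricConnection (O : Set E) (g : E → E →L[ℝ] E →L[ℝ] ℝ)
    (Γ : E → E →L[ℝ] E →L[ℝ] E) : Prop where
  isOpen : IsOpen O
  contDiffOn_metric : ContDiffOn ℝ ∞ g O
  contDiffOn_connection : ContDiffOn ℝ ∞ Γ O
  symm (y v w : E) : g y v w = g y w v
  fderiv_metric {y : E} (hy : y ∈ O) (u v w : E) :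
    fderiv ℝ g y u v w = g y (Γ y v u) w + g y v (Γ y w u)
  torsion_self {y : E} (hy : y ∈ O) (u v : E) : g y (Γ y v u) v = g y (Γ y u v) v

/-- The derivative in the direction `v` of the vector field `Y` along the map `x`. -/
def derivAlong (Γ : E → E →L[ℝ] E →L[ℝ] E) (x Y : P → E) (v p : P) : E :=
  fderiv ℝ Y p v + Γ (x p) (Y p) (fderiv ℝ x p v)

/-- The curvature `R(u, v)w` of the connection with Christoffel symbol `Γ`. -/
def curvatureCoords (Γ : E → E →L[ℝ] E →L[ℝ] E) (y u v w : E) : E :=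
  fderiv ℝ Γ y u w v - fderiv ℝ Γ y v w u + Γ y (Γ y w v) u - Γ y (Γ y w u) v

variable {O : Set E} {g : E → E →L[ℝ] E →L[ℝ] ℝ} {Γ : E → E →L[ℝ] E →L[ℝ] E} {x Y Z : P → E} {p : P}

theorem contDiffAt_fderiv_apply (hY : ContDiffAt ℝ ∞ Y p) (v : P) :
    ContDiffAt ℝ ∞ (fun q ↦ fderiv ℝ Y q v) p :=
  (hY.fderiv_right (m := ∞) (by simp)).clm_apply contDiffAt_const

theorem fderiv_fderiv_apply_comm (hY : ContDiffAt ℝ ∞ Y p) (u v : P) :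
    fderiv ℝ (fun q ↦ fderiv ℝ Y q v) p u = fderiv ℝ (fun q ↦ fderiv ℝ Y q u) p v := by
  have h1 : DifferentiableAt ℝ (fderiv ℝ Y) p :=
    (hY.fderiv_right (m := ∞) (by simp)).differentiableAt (by simp)
  have h2 (u v : P) : fderiv ℝ (fun q ↦ fderiv ℝ Y q v) p u = fderiv ℝ (fderiv ℝ Y) p u v := by
    rw [(h1.hasFDerivAt.clm_apply (hasFDerivAt_const v p)).fderiv]
    simp
  rw [h2, h2]
  exact (hY.isSymmSndFDerivAt (by simpa using ENat.LEInfty.out)).eq u v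

/-- Second derivatives of `x` are symmetric, so only the Christoffel terms fail to match; their
difference is the torsion T(x_u, x_v). -/
theorem derivAlong_comm (hx : ContDiffAt ℝ ∞ x p) (u v : P) :
    derivAlong Γ x (fun q ↦ fderiv ℝ x q v) u p = derivAlong Γ x (fun q ↦ fderiv ℝ x q u) v p
      + (Γ (x p) (fderiv ℝ x p v) (fderiv ℝ x p u) - Γ (x p) (fderiv ℝ x p u)
        (fderiv ℝ x p v)) := by
  rw [derivAlong, derivAlong, fderiv_fderiv_apply_comm hx u v]
  abel

namespace IsSkewMetricConnection

variable (H : IsSkewMetricConnection O g Γ)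
include H

theorem contDiffAt_connection {y : E} (hy : y ∈ O) : ContDiffAt ℝ ∞ Γ y :=
  H.contDiffOn_connection.contDiffAt (H.isOpen.mem_nhds hy)

theorem contDiffAt_metric {y : E} (hy : y ∈ O) : ContDiffAt ℝ ∞ g y :=
  H.contDiffOn_metric.contDiffAt (H.isOpen.mem_nhds hy)

theorem fderiv_inner (hp : x p ∈ O) (hx : DifferentiableAt ℝ x p) (hY : DifferentiableAt ℝ Y p)
    (hZ : DifferentiableAt ℝ Z p) (v : P) :
    fderiv ℝ (fun q ↦ g (x q) (Y q) (Z q)) p v =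
      g (x p) (derivAlong Γ x Y v p) (Z p) + g (x p) (Y p) (derivAlong Γ x Z v p) := by
  have hg : HasFDerivAt (fun q ↦ g (x q)) _ p := ((H.contDiffAt_metric hp).differentiableAt
    (by simp)).hasFDerivAt.comp p hx.hasFDerivAt
  have h1 := ((hg.clm_apply hY.hasFDerivAt).clm_apply hZ.hasFDerivAt).fderiv
  rw [h1]
  simp [derivAlong, H.fderiv_metric hp]
  abel

theorem contDiffAt_derivAlong (hp : x p ∈ O) (hx : ContDiffAt ℝ ∞ x p) (hY : ContDiffAt ℝ ∞ Y p)
    (v : P) : ContDiffAt ℝ ∞ (derivAlong Γ x Y v) p :=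
  (contDiffAt_fderiv_apply hY v).add
    ((((H.contDiffAt_connection hp).comp p hx).clm_apply hY).clm_apply
      (contDiffAt_fderiv_apply hx v))

/-- The definition of curvature, pulled back by `x`. Constant directions of `P` commute, so there is
no bracket term, and the second derivatives of `x` and `Y` cancel by symmetry. -/
theorem derivAlong_derivAlong_comm (hp : x p ∈ O) (hx : ContDiffAt ℝ ∞ x p)
    (hY : ContDiffAt ℝ ∞ Y p) (u v : P) :
    derivAlong Γ x (derivAlong Γ x Y v) u p = derivAlong Γ x (derivAlong Γ x Y u) v p
      + curvatureCoords Γ (x p) (fderiv ℝ x p u) (fderiv ℝ x p v) (Y p) := by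
  have key (u v : P) : fderiv ℝ (derivAlong Γ x Y v) p u = fderiv ℝ (fun q ↦ fderiv ℝ Y q v) p u
      + (Γ (x p) (Y p) (fderiv ℝ (fun q ↦ fderiv ℝ x q v) p u)
        + (Γ (x p) (fderiv ℝ Y p u) (fderiv ℝ x p v)
          + fderiv ℝ Γ (x p) (fderiv ℝ x p u) (Y p) (fderiv ℝ x p v))) := by
    have hΓ : HasFDerivAt (fun q ↦ Γ (x q)) _ p := ((H.contDiffAt_connection hp).differentiableAt
      (by simp)).hasFDerivAt.comp p (hx.differentiableAt (by simp)).hasFDerivAt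
    have h1 := ((contDiffAt_fderiv_apply hY v).differentiableAt (by simp)).hasFDerivAt
    have h2 := ((contDiffAt_fderiv_apply hx v).differentiableAt (by simp)).hasFDerivAt
    have h3 := h1.add
      ((hΓ.clm_apply (hY.differentiableAt (by simp)).hasFDerivAt).clm_apply h2)
    have h4 : derivAlong Γ x Y v = (fun q ↦ fderiv ℝ Y q v) + fun q ↦
      Γ (x q) (Y q) (fderiv ℝ x q v) := rfl
    rw [h4, h3.fderiv]
    simp
  have e (v : P) (Y : P → E) :
    derivAlong Γ x Y v p = fderiv ℝ Y p v + Γ (x p) (Y p) (fderiv ℝ x p v) := rfl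
  rw [e u (derivAlong Γ x Y v), e v (derivAlong Γ x Y u), key, key, fderiv_fderiv_apply_comm hY u v,
    fderiv_fderiv_apply_comm hx u v]
  simp only [derivAlong, curvatureCoords, map_add, add_apply]
  abel

/-- Take the identity as the map and `w` as a constant field. The antisymmetric part in `u`, `v` of
the second derivative of g(w, w) is zero, and for a metric connection it is 2 g(R(u, v)w, w). -/
theorem inner_curvature_self {y : E} (hy : y ∈ O) (u v w : E) :
    g y (curvatureCoords Γ y u v w) w = 0 := by
  have hid : ContDiffAt ℝ ∞ (fun z : E ↦ z) y := contDiffAt_id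
  have hw : ContDiffAt ℝ ∞ (fun _ : E ↦ w) y := contDiffAt_const
  have hD (v : E) := H.contDiffAt_derivAlong (x := fun z ↦ z) hy hid hw v
  have h1 (v : E) : (fun z ↦ fderiv ℝ (fun z ↦ g z w w) z v) =ᶠ[𝓝 y]
      fun z ↦ (2 : ℝ) * g z (derivAlong Γ (fun z ↦ z) (fun _ ↦ w) v z) w := by
    filter_upwards [H.isOpen.mem_nhds hy] with z hz
    rw [H.fderiv_inner (x := fun z ↦ z) (Y := fun _ ↦ w) (Z := fun _ ↦ w) hz differentiableAt_fun_id
      (differentiableAt_const _) (differentiableAt_const _) v, H.symm z w]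
    ring
  have h2 (u v : E) : fderiv ℝ (fun z ↦ fderiv ℝ (fun z ↦ g z w w) z v) y u =
      2 * (g y (derivAlong Γ (fun z ↦ z) (derivAlong Γ (fun z ↦ z) (fun _ ↦ w) v) u y) w
        + g y (derivAlong Γ (fun z ↦ z) (fun _ ↦ w) v y)
          (derivAlong Γ (fun z ↦ z) (fun _ ↦ w) u y)) := by
    have hd : DifferentiableAt ℝ (fun z ↦ g z (derivAlong Γ (fun z ↦ z) (fun _ ↦ w) v z) w) y :=
      (((H.contDiffAt_metric hy).clm_apply (hD v)).clm_apply hw).differentiableAt (by simp)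
    rw [(h1 v).fderiv_eq, fderiv_const_mul hd, smul_apply, smul_eq_mul,
      H.fderiv_inner (x := fun z ↦ z) (Z := fun _ ↦ w) hy differentiableAt_fun_id
        ((hD v).differentiableAt (by simp)) (differentiableAt_const _) u]
  have h3 : ContDiffAt ℝ ∞ (fun z ↦ g z w w) y :=
    ((H.contDiffAt_metric hy).clm_apply hw).clm_apply hw
  have h4 := fderiv_fderiv_apply_comm h3 u v
  have h5 := H.derivAlong_derivAlong_comm (x := fun z ↦ z) hy hid hw u v
  rw [h2, h2, h5, map_add, add_apply, H.symm y (derivAlong Γ (fun z ↦ z) (fun _ ↦ w) v y)] at h4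
  simp only [fderiv_fun_id, ContinuousLinearMap.coe_id', id_eq] at h4
  linarith

theorem curvatureCoords_add (y u v w w' : E) : curvatureCoords Γ y u v (w + w') =
    curvatureCoords Γ y u v w + curvatureCoords Γ y u v w' := by
  simp only [curvatureCoords, map_add, add_apply]
  abel

theorem inner_curvature_swap {y : E} (hy : y ∈ O) (u v w z : E) :
    g y (curvatureCoords Γ y u v w) z = -g y (curvatureCoords Γ y u v z) w := by
  have h1 := H.inner_curvature_self hy u v (w + z)
  simp only [H.curvatureCoords_add, map_add, add_apply, H.inner_curvature_self hy] at h1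
  linarith

/-- First variation: exchanging the derivatives in g(D_v x_t, x_t) costs g(T(x_v, x_t), x_t), which
is zero for skew torsion. -/
theorem fderiv_energyDensity (hp : x p ∈ O) (hx : ContDiffAt ℝ ∞ x p) (t v : P) :
    fderiv ℝ (fun q ↦ (1 / 2 : ℝ) * g (x q) (fderiv ℝ x q t) (fderiv ℝ x q t)) p v =
      g (x p) (derivAlong Γ x (fun q ↦ fderiv ℝ x q v) t p) (fderiv ℝ x p t) := by
  have h1 := contDiffAt_fderiv_apply hx t
  have hd : DifferentiableAt ℝ (fun q ↦ g (x q) (fderiv ℝ x q t) (fderiv ℝ x q t)) p :=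
    ((((H.contDiffAt_metric hp).comp p hx).clm_apply h1).clm_apply h1).differentiableAt (by simp)
  rw [fderiv_const_mul hd, smul_apply, smul_eq_mul,
    H.fderiv_inner hp (hx.differentiableAt (by simp)) (h1.differentiableAt (by simp))
      (h1.differentiableAt (by simp)), H.symm _ (fderiv ℝ x p t), derivAlong_comm hx v t, map_add,
    add_apply, map_sub, sub_apply, H.torsion_self hp]
  ring

/-- The pointwise second variation formula. -/
theorem second_variation (hp : x p ∈ O) (hx' : ∀ᶠ q in 𝓝 p, ContDiffAt ℝ ∞ x q) (t u v : P)
    (hgeo : derivAlong Γ x (fun q ↦ fderiv ℝ x q t) t p = 0) :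
    fderiv ℝ (fun q ↦ fderiv ℝ
      (fun q ↦ (1 / 2 : ℝ) * g (x q) (fderiv ℝ x q t) (fderiv ℝ x q t)) q v) p u =
    g (x p) (derivAlong Γ x (fun q ↦ fderiv ℝ x q u) t p)
      (derivAlong Γ x (fun q ↦ fderiv ℝ x q v) t p)
    + g (x p) (Γ (x p) (fderiv ℝ x p t) (fderiv ℝ x p u)
        - Γ (x p) (fderiv ℝ x p u) (fderiv ℝ x p t)) (derivAlong Γ x (fun q ↦ fderiv ℝ x q v) t p)
    - g (x p) (curvatureCoords Γ (x p) (fderiv ℝ x p u) (fderiv ℝ x p t) (fderiv ℝ x p t))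
        (fderiv ℝ x p v)
    + fderiv ℝ (fun q ↦ g (x q) (derivAlong Γ x (fun q ↦ fderiv ℝ x q v) u q) (fderiv ℝ x q t))
        p t := by
  have hx := hx'.self_of_nhds
  have hxd := hx.differentiableAt (by simp)
  have hd (v : P) := contDiffAt_fderiv_apply hx v
  have hD (u v : P) := (H.contDiffAt_derivAlong hp hx (hd v) u).differentiableAt (by simp)
  -- The first variation is needed on a whole neighbourhood, since it is differentiated again; the
  -- geodesic equation is used only at `p`.
  have h1 : (fun q ↦ fderiv ℝ
      (fun q ↦ (1 / 2 : ℝ) * g (x q) (fderiv ℝ x q t) (fderiv ℝ x q t)) q v) =ᶠ[𝓝 p]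
      fun q ↦ g (x q) (derivAlong Γ x (fun q ↦ fderiv ℝ x q v) t q) (fderiv ℝ x q t) := by
    filter_upwards [hx.continuousAt (H.isOpen.mem_nhds hp), hx'] with q hq hxq
    exact H.fderiv_energyDensity hq hxq t v
  -- The second use of the product rule expands the total t-derivative on the right-hand side;
  -- `hgeo` removes its term containing D_t x_t.
  rw [h1.fderiv_eq, H.fderiv_inner hp hxd (hD t v) ((hd t).differentiableAt (by simp)),
    H.fderiv_inner hp hxd (hD u v) ((hd t).differentiableAt (by simp)), hgeo, map_zero,
    H.derivAlong_derivAlong_comm hp hx (hd v), derivAlong_comm hx u t, map_add, add_apply,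
    H.inner_curvature_swap hp _ _ (fderiv ℝ x p v), map_add,
    H.symm _ (derivAlong Γ x (fun q ↦ fderiv ℝ x q v) t p),
    H.symm _ (derivAlong Γ x (fun q ↦ fderiv ℝ x q v) t p)]
  ring

end IsSkewMetricConnection

end SecondVariationCalculus

section
variable {E : Type*} [NormedAddCommGroup E] [NormedSpace ℝ E]
  [FiniteDimensional ℝ E] [CompleteSpace E]
  {M : Type*} [TopologicalSpace M] [ChartedSpace E M] [IsManifold 𝓘(ℝ, E) ∞ M]
  [RiemannianBundle (fun x : M ↦ TangentSpace 𝓘(ℝ, E) x)]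
  [IsContMDiffRiemannianBundle 𝓘(ℝ, E) ∞ E (fun x : M ↦ TangentSpace 𝓘(ℝ, E) x)]

theorem HermitianStructure.isSkewMetricConnection (h : HermitianStructure E M) (x₀ : M) :
    IsSkewMetricConnection (extChartAt 𝓘(ℝ, E) x₀).target (metricCoords x₀)
      (christoffel h.stromingerBismut x₀) where
  isOpen := isOpen_extChartAt_target x₀
  contDiffOn_metric := contDiffOn_metricCoords x₀
  contDiffOn_connection := h.contDiffOn_christoffel_stromingerBismut x₀
  symm := metricCoords_symm x₀
  fderiv_metric hy := h.fderiv_metricCoords_eq hy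
  torsion_self hy := h.metricCoords_torsion_self hy

end

/-! ### Differentiation under the integral sign -/

section ParametricIntegral

/-- Differentiation under the integral sign, for a continuous derivative. -/
theorem hasDerivAt_integral_of_continuousOn {F F' : ℝ → ℝ → ℝ} {a b s₀ : ℝ} {U : Set ℝ}
    (hab : a ≤ b) (hU : U ∈ 𝓝 s₀) (hF : ∀ s ∈ U, ContinuousOn (F s) (Icc a b))
    (hF' : ContinuousOn (Function.uncurry F') (U ×ˢ Icc a b))
    (hd : ∀ s ∈ U, ∀ t ∈ Icc a b, HasDerivAt (fun s ↦ F s t) (F' s t) s) :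
    HasDerivAt (fun s ↦ ∫ t in a..b, F s t) (∫ t in a..b, F' s₀ t) s₀ := by
  obtain ⟨r, hr, hrU⟩ := Metric.nhds_basis_closedBall.mem_iff.1 hU
  have hs₀ : s₀ ∈ Metric.closedBall s₀ r := Metric.mem_closedBall_self hr.le
  have hsub : uIoc a b ⊆ Icc a b := uIoc_of_le hab ▸ Ioc_subset_Icc_self
  -- Continuity of the derivative on a compact product supplies a constant dominating function.
  obtain ⟨C, hC⟩ := ((isCompact_closedBall s₀ r).prod isCompact_Icc).exists_bound_of_continuousOn
    (hF'.mono (prod_mono hrU (Subset.refl (Icc a b))))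
  have hmeas {f : ℝ → ℝ} (hf : ContinuousOn f (Icc a b)) :
      AEStronglyMeasurable f (volume.restrict (uIoc a b)) :=
    (hf.mono hsub).aestronglyMeasurable measurableSet_uIoc
  refine (intervalIntegral.hasDerivAt_integral_of_dominated_loc_of_deriv_le (bound := fun _ ↦ C)
    (Metric.closedBall_mem_nhds s₀ hr) ?_ ?_ ?_ ?_ intervalIntegrable_const ?_).2
  · filter_upwards [hU] with s hs
    exact hmeas (hF s hs)
  · exact ContinuousOn.intervalIntegrable_of_Icc hab (hF s₀ (hrU hs₀))
  · refine hmeas (hF'.comp (f := fun t ↦ (s₀, t)) (by fun_prop) fun t ht ↦ ⟨hrU hs₀, ht⟩)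
  · exact Filter.Eventually.of_forall fun t ht s hs ↦ hC (s, t) ⟨hs, hsub ht⟩
  · exact Filter.Eventually.of_forall fun t ht s hs ↦ hd s (hrU hs) t (hsub ht)

end ParametricIntegral

/-! ### Partial derivatives and integrals over the domain of a variation -/

section VariationDomain

variable {a b ε₁ ε₂ : ℝ} {G : Type*} [NormedAddCommGroup G] [NormedSpace ℝ G]

theorem uniqueDiffOn_variationDomain (hab : a < b) :
    UniqueDiffOn ℝ (variationDomain a b ε₁ ε₂) :=
  (uniqueDiffOn_Icc hab).prod (isOpen_Ioo.uniqueDiffOn.prod isOpen_Ioo.uniqueDiffOn)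

theorem variationDomain_mem_nhds {t : ℝ} (ht : t ∈ Ioo a b) (hε₁ : 0 < ε₁) (hε₂ : 0 < ε₂) :
    variationDomain a b ε₁ ε₂ ∈ 𝓝 (t, (0 : ℝ), (0 : ℝ)) :=
  prod_mem_nhds (Icc_mem_nhds ht.1 ht.2) (prod_mem_nhds
    (Ioo_mem_nhds (neg_neg_of_pos hε₁) hε₁) (Ioo_mem_nhds (neg_neg_of_pos hε₂) hε₂))

variable {F : ℝ × ℝ × ℝ → G} {t s₁ s₂ : ℝ}

/-- The domain is open in the transversal directions even above the end points of `[a, b]`, so the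
derivative within it is a two-sided partial derivative there. In the direction of t it is only
one-sided at the ends. -/
theorem hasDerivAt_snd_snd (ht : t ∈ Icc a b) (hs₁ : s₁ ∈ Ioo (-ε₁) ε₁)
    (hs₂ : s₂ ∈ Ioo (-ε₂) ε₂)
    (hF : DifferentiableWithinAt ℝ F (variationDomain a b ε₁ ε₂) (t, s₁, s₂)) :
    HasDerivAt (fun s ↦ F (t, s₁, s))
      (fderivWithin ℝ F (variationDomain a b ε₁ ε₂) (t, s₁, s₂) (0, 0, 1)) s₂ := by
  have h1 : HasDerivAt (fun s : ℝ ↦ (t, s₁, s)) (0, 0, 1) s₂ :=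
    (hasDerivAt_const s₂ t).prodMk ((hasDerivAt_const s₂ s₁).prodMk (hasDerivAt_id s₂))
  have h2 : MapsTo (fun s : ℝ ↦ (t, s₁, s)) (Ioo (-ε₂) ε₂) (variationDomain a b ε₁ ε₂) :=
    fun s hs ↦ ⟨ht, hs₁, hs⟩
  exact (hF.hasFDerivWithinAt.comp_hasDerivWithinAt s₂ h1.hasDerivWithinAt h2).hasDerivAt
    (isOpen_Ioo.mem_nhds hs₂)

theorem hasDerivAt_snd_fst (ht : t ∈ Icc a b) (hs₁ : s₁ ∈ Ioo (-ε₁) ε₁)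
    (hs₂ : s₂ ∈ Ioo (-ε₂) ε₂)
    (hF : DifferentiableWithinAt ℝ F (variationDomain a b ε₁ ε₂) (t, s₁, s₂)) :
    HasDerivAt (fun s ↦ F (t, s, s₂))
      (fderivWithin ℝ F (variationDomain a b ε₁ ε₂) (t, s₁, s₂) (0, 1, 0)) s₁ := by
  have h1 : HasDerivAt (fun s : ℝ ↦ (t, s, s₂)) (0, 1, 0) s₁ :=
    (hasDerivAt_const s₁ t).prodMk ((hasDerivAt_id s₁).prodMk (hasDerivAt_const s₁ s₂))
  have h2 : MapsTo (fun s : ℝ ↦ (t, s, s₂)) (Ioo (-ε₁) ε₁) (variationDomain a b ε₁ ε₂) :=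
    fun s hs ↦ ⟨ht, hs, hs₂⟩
  exact (hF.hasFDerivWithinAt.comp_hasDerivWithinAt s₁ h1.hasDerivWithinAt h2).hasDerivAt
    (isOpen_Ioo.mem_nhds hs₁)

theorem hasDerivWithinAt_fst (hs₁ : s₁ ∈ Ioo (-ε₁) ε₁)
    (hs₂ : s₂ ∈ Ioo (-ε₂) ε₂)
    (hF : DifferentiableWithinAt ℝ F (variationDomain a b ε₁ ε₂) (t, s₁, s₂)) :
    HasDerivWithinAt (fun s ↦ F (s, s₁, s₂))
      (fderivWithin ℝ F (variationDomain a b ε₁ ε₂) (t, s₁, s₂) (1, 0, 0)) (Icc a b) t := by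
  have h1 : HasDerivAt (fun s : ℝ ↦ (s, s₁, s₂)) (1, 0, 0) t :=
    (hasDerivAt_id t).prodMk ((hasDerivAt_const t s₁).prodMk (hasDerivAt_const t s₂))
  have h2 : MapsTo (fun s : ℝ ↦ (s, s₁, s₂)) (Icc a b) (variationDomain a b ε₁ ε₂) :=
    fun s hs ↦ ⟨hs, hs₁, hs₂⟩
  exact hF.hasFDerivWithinAt.comp_hasDerivWithinAt t h1.hasDerivWithinAt h2

theorem contDiffOn_fderivWithin_apply (hab : a < b)
    (hF : ContDiffOn ℝ ∞ F (variationDomain a b ε₁ ε₂)) (v : ℝ × ℝ × ℝ) :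
    ContDiffOn ℝ ∞ (fun p ↦ fderivWithin ℝ F (variationDomain a b ε₁ ε₂) p v)
      (variationDomain a b ε₁ ε₂) :=
  (hF.fderivWithin (uniqueDiffOn_variationDomain hab) (by simp)).clm_apply contDiffOn_const

variable {f : ℝ × ℝ × ℝ → ℝ}

theorem hasDerivAt_integral_snd_snd (hab : a < b)
    (hf : ContDiffOn ℝ ∞ f (variationDomain a b ε₁ ε₂)) (hs₁ : s₁ ∈ Ioo (-ε₁) ε₁)
    (hs₂ : s₂ ∈ Ioo (-ε₂) ε₂) :
    HasDerivAt (fun s ↦ ∫ t in a..b, f (t, s₁, s))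
      (∫ t in a..b, fderivWithin ℝ f (variationDomain a b ε₁ ε₂) (t, s₁, s₂) (0, 0, 1)) s₂ := by
  have h2 := (contDiffOn_fderivWithin_apply hab hf (0, 0, 1)).continuousOn
  refine hasDerivAt_integral_of_continuousOn (F := fun s t ↦ f (t, s₁, s)) (F' := fun s t ↦
    fderivWithin ℝ f (variationDomain a b ε₁ ε₂) (t, s₁, s) (0, 0, 1)) hab.le
    (isOpen_Ioo.mem_nhds hs₂) (fun s hs ↦ ?_) ?_ fun s hs t ht ↦ ?_
  · exact hf.continuousOn.comp (f := fun t ↦ (t, s₁, s)) (by fun_prop) fun t ht ↦ ⟨ht, hs₁, hs⟩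
  · exact h2.comp (f := fun q : ℝ × ℝ ↦ (q.2, s₁, q.1)) (by fun_prop) fun q hq ↦ ⟨hq.2, hs₁, hq.1⟩
  · exact hasDerivAt_snd_snd ht hs₁ hs
      (hf.differentiableOn (by simp) (t, s₁, s) ⟨ht, hs₁, hs⟩)

theorem hasDerivAt_integral_snd_fst (hab : a < b)
    (hf : ContDiffOn ℝ ∞ f (variationDomain a b ε₁ ε₂)) (hs₁ : s₁ ∈ Ioo (-ε₁) ε₁)
    (hs₂ : s₂ ∈ Ioo (-ε₂) ε₂) :
    HasDerivAt (fun s ↦ ∫ t in a..b, f (t, s, s₂))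
      (∫ t in a..b, fderivWithin ℝ f (variationDomain a b ε₁ ε₂) (t, s₁, s₂) (0, 1, 0)) s₁ := by
  have h2 := (contDiffOn_fderivWithin_apply hab hf (0, 1, 0)).continuousOn
  refine hasDerivAt_integral_of_continuousOn (F := fun s t ↦ f (t, s, s₂)) (F' := fun s t ↦
    fderivWithin ℝ f (variationDomain a b ε₁ ε₂) (t, s, s₂) (0, 1, 0)) hab.le
    (isOpen_Ioo.mem_nhds hs₁) (fun s hs ↦ ?_) ?_ fun s hs t ht ↦ ?_
  · exact hf.continuousOn.comp (f := fun t ↦ (t, s, s₂)) (by fun_prop) fun t ht ↦ ⟨ht, hs, hs₂⟩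
  · exact h2.comp (f := fun q : ℝ × ℝ ↦ (q.2, q.1, s₂)) (by fun_prop) fun q hq ↦ ⟨hq.2, hq.1, hs₂⟩
  · exact hasDerivAt_snd_fst ht hs hs₂
      (hf.differentiableOn (by simp) (t, s, s₂) ⟨ht, hs, hs₂⟩)

/-- The mixed second derivative of a parametric integral. -/
theorem hasDerivAt_deriv_integral (hab : a < b) (hε₁ : 0 < ε₁) (hε₂ : 0 < ε₂)
    (hf : ContDiffOn ℝ ∞ f (variationDomain a b ε₁ ε₂)) :
    HasDerivAt (fun s₁ ↦ deriv (fun s₂ ↦ ∫ t in a..b, f (t, s₁, s₂)) 0)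
      (∫ t in a..b, fderivWithin ℝ (fun p ↦ fderivWithin ℝ f (variationDomain a b ε₁ ε₂) p
        (0, 0, 1)) (variationDomain a b ε₁ ε₂) (t, 0, 0) (0, 1, 0)) 0 := by
  have h1 : (0 : ℝ) ∈ Ioo (-ε₁) ε₁ := ⟨neg_neg_of_pos hε₁, hε₁⟩
  have h2 : (0 : ℝ) ∈ Ioo (-ε₂) ε₂ := ⟨neg_neg_of_pos hε₂, hε₂⟩
  refine (hasDerivAt_integral_snd_fst hab (contDiffOn_fderivWithin_apply hab hf (0, 0, 1))
    h1 h2).congr_of_eventuallyEq ?_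
  -- For every s₁ near 0 the inner derivative is itself the integral of a smooth function, to which
  -- the one-variable statement applies again.
  filter_upwards [isOpen_Ioo.mem_nhds h1] with s hs
  exact (hasDerivAt_integral_snd_snd hab hf hs h2).deriv

end VariationDomain

/-! ### A variation and its covariant derivatives in a chart -/

section VariationCoordinates

set_option maxSynthPendingDepth 3

variable {E : Type*} [NormedAddCommGroup E] [NormedSpace ℝ E]
  [FiniteDimensional ℝ E] [CompleteSpace E]
  {M : Type*} [TopologicalSpace M] [ChartedSpace E M] [IsManifold 𝓘(ℝ, E) ∞ M]

theorem coords_mfderivWithin {P : Type*} [NormedAddCommGroup P] [NormedSpace ℝ P] {f : P → M}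
    {S : Set P} {p : P} {x₀ : M} (hx : f p ∈ (chartAt E x₀).source)
    (hS : UniqueDiffWithinAt ℝ S p) (hf : MDiffAt[S] f p) (v : P) :
    coords x₀ (f p) (mfderivWithin 𝓘(ℝ, P) 𝓘(ℝ, E) f S p v) =
      fderivWithin ℝ (fun q ↦ extChartAt 𝓘(ℝ, E) x₀ (f q)) S p v := by
  have := mfderiv_comp_mfderivWithin (I := 𝓘(ℝ, P)) (I' := 𝓘(ℝ, E)) (I'' := 𝓘(ℝ, E))
    p (mdifferentiableAt_extChartAt (I := 𝓘(ℝ, E)) hx) hf hS.uniqueMDiffWithinAt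
  rw [mfderivWithin_eq_fderivWithin, ← coords_eq_mfderiv hx] at this
  exact congr($this.symm v)

variable {a b ε₁ ε₂ : ℝ} {α : ℝ × ℝ × ℝ → M} {x₀ : M} {p : ℝ × ℝ × ℝ} {t s₁ s₂ : ℝ}

/-- The coordinates of a variation in the chart at `x₀`. -/
abbrev variationCoords (x₀ : M) (α : ℝ × ℝ × ℝ → M) (q : ℝ × ℝ × ℝ) : E :=
  extChartAt 𝓘(ℝ, E) x₀ (α q)

section

variable (hα : ContMDiffOn 𝓘(ℝ, ℝ × ℝ × ℝ) 𝓘(ℝ, E) ∞ α (variationDomain a b ε₁ ε₂))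
include hα

theorem mdiffWithinAt_variation (hp : p ∈ variationDomain a b ε₁ ε₂) :
    MDifferentiableWithinAt 𝓘(ℝ, ℝ × ℝ × ℝ) 𝓘(ℝ, E) α (variationDomain a b ε₁ ε₂) p :=
  (hα p hp).mdifferentiableWithinAt (by simp)

theorem eventually_mem_chart_source (hp : p ∈ variationDomain a b ε₁ ε₂)
    (hx : α p ∈ (chartAt E x₀).source) :
    ∀ᶠ q in 𝓝[variationDomain a b ε₁ ε₂] p, q ∈ variationDomain a b ε₁ ε₂ ∧
      α q ∈ (chartAt E x₀).source := by
  filter_upwards [self_mem_nhdsWithin,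
    (hα p hp).continuousWithinAt ((chartAt E x₀).open_source.mem_nhds hx)] with q h1 h2
  exact ⟨h1, h2⟩

theorem contDiffWithinAt_variationCoords (hp : p ∈ variationDomain a b ε₁ ε₂)
    (hx : α p ∈ (chartAt E x₀).source) :
    ContDiffWithinAt ℝ ∞ (variationCoords (E := E) x₀ α) (variationDomain a b ε₁ ε₂) p := by
  rw [← contMDiffWithinAt_iff_contDiffWithinAt]
  exact (contMDiffAt_extChartAt' hx).comp_contMDiffWithinAt p (hα p hp)

theorem contDiffWithinAt_fderivWithin_variationCoords (hab : a < b)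
    (hp : p ∈ variationDomain a b ε₁ ε₂)
    (hx : α p ∈ (chartAt E x₀).source) (v : ℝ × ℝ × ℝ) :
    ContDiffWithinAt ℝ ∞ (fun q ↦ fderivWithin ℝ (variationCoords (E := E) x₀ α)
      (variationDomain a b ε₁ ε₂) q v) (variationDomain a b ε₁ ε₂) p :=
  ((contDiffWithinAt_variationCoords hα hp hx).fderivWithin_right
    (uniqueDiffOn_variationDomain hab) (m := ∞) (by simp) hp).clm_apply contDiffWithinAt_const

theorem coords_pushforward (hab : a < b) (hp : p ∈ variationDomain a b ε₁ ε₂)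
    (hx : α p ∈ (chartAt E x₀).source)
    (v : ℝ × ℝ × ℝ) :
    coords x₀ (α p) (pushforward (variationDomain a b ε₁ ε₂) α v p) = fderivWithin ℝ
      (variationCoords (E := E) x₀ α) (variationDomain a b ε₁ ε₂) p v :=
  coords_mfderivWithin hx (uniqueDiffOn_variationDomain hab p hp) (mdiffWithinAt_variation hα hp) v

theorem coords_pushforward_eventuallyEq (hab : a < b) (hp : p ∈ variationDomain a b ε₁ ε₂)
    (hx : α p ∈ (chartAt E x₀).source) (v : ℝ × ℝ × ℝ) :
    (fun q ↦ coords x₀ (α q) (pushforward (variationDomain a b ε₁ ε₂) α v q))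
      =ᶠ[𝓝[variationDomain a b ε₁ ε₂] p]
      fun q ↦ fderivWithin ℝ (variationCoords (E := E) x₀ α) (variationDomain a b ε₁ ε₂) q v := by
  filter_upwards [eventually_mem_chart_source hα hp hx] with q hq
  exact coords_pushforward hα hab hq.1 hq.2 v

theorem coords_covDerivAlong_pushforward
    (cov : CovariantDerivative 𝓘(ℝ, E) E (fun x : M ↦ TangentSpace 𝓘(ℝ, E) x)) (hab : a < b)
    (hp : p ∈ variationDomain a b ε₁ ε₂) (hx : α p ∈ (chartAt E x₀).source) (u v : ℝ × ℝ × ℝ) :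
    coords x₀ (α p) (covDerivAlong cov α (variationDomain a b ε₁ ε₂)
      (pushforward (variationDomain a b ε₁ ε₂) α v) p u) =
      fderivWithin ℝ (fun q ↦ fderivWithin ℝ (variationCoords (E := E) x₀ α)
        (variationDomain a b ε₁ ε₂) q v) (variationDomain a b ε₁ ε₂) p u
      + christoffel cov x₀ (variationCoords x₀ α p)
        (fderivWithin ℝ (variationCoords (E := E) x₀ α) (variationDomain a b ε₁ ε₂) p v)
        (fderivWithin ℝ (variationCoords (E := E) x₀ α) (variationDomain a b ε₁ ε₂) p u) := by
  have h1 := coords_pushforward_eventuallyEq hα hab hp hx v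
  have hS := uniqueDiffOn_variationDomain hab p hp
  have hV : DifferentiableWithinAt ℝ (fun q ↦ coords x₀ (α q)
    (pushforward (variationDomain a b ε₁ ε₂) α v q)) (variationDomain a b ε₁ ε₂) p :=
    ((contDiffWithinAt_fderivWithin_variationCoords hα hab hp hx v).differentiableWithinAt
      (by simp)).congr_of_eventuallyEq_of_mem h1 hp
  rw [coords_covDerivAlong hx hp hS (mdiffWithinAt_variation hα hp) hV u,
    h1.fderivWithin_eq_of_mem hp, coords_pushforward hα hab hp hx,
    coords_mfderivWithin hx hS (mdiffWithinAt_variation hα hp)]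

/-- The chain rule for the inclusion `t ↦ (t, s₁, s₂)`. It also holds at the end points, where both
sides are derivatives within a set with unique derivatives. -/
theorem velocity_eq_pushforward (hab : a < b) (ht : t ∈ Icc a b) (hs₁ : s₁ ∈ Ioo (-ε₁) ε₁)
    (hs₂ : s₂ ∈ Ioo (-ε₂) ε₂) :
    velocity (E := E) a b (fun t ↦ α (t, s₁, s₂)) t = pushforward (variationDomain a b ε₁ ε₂) α
      (1, 0, 0) (t, s₁, s₂) := by
  have h1 : HasFDerivWithinAt (fun s : ℝ ↦ (s, s₁, s₂)) (ContinuousLinearMap.toSpanSingleton ℝ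
      ((1 : ℝ), (0 : ℝ), (0 : ℝ))) (Icc a b) t :=
    ((hasDerivAt_id t).prodMk ((hasDerivAt_const t s₁).prodMk
      (hasDerivAt_const t s₂))).hasFDerivAt.hasFDerivWithinAt
  have h2 := mfderivWithin_comp (I := 𝓘(ℝ, ℝ)) (I' := 𝓘(ℝ, ℝ × ℝ × ℝ)) (I'' := 𝓘(ℝ, E))
    (f := fun s : ℝ ↦ (s, s₁, s₂)) (u := variationDomain a b ε₁ ε₂) t
    (mdiffWithinAt_variation hα (p := (t, s₁, s₂)) ⟨ht, hs₁, hs₂⟩)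
    h1.differentiableWithinAt.mdifferentiableWithinAt (s := Icc a b)
    (fun s hs ↦ ⟨hs, hs₁, hs₂⟩) (uniqueDiffOn_Icc hab t ht).uniqueMDiffWithinAt
  rw [mfderivWithin_eq_fderivWithin, h1.fderivWithin (uniqueDiffOn_Icc hab t ht)] at h2
  refine (congr($h2 (1 : ℝ))).trans ?_
  exact congrArg (mfderivWithin 𝓘(ℝ, ℝ × ℝ × ℝ) 𝓘(ℝ, E) α (variationDomain a b ε₁ ε₂) (t, s₁, s₂))
    (one_smul ℝ ((1 : ℝ), (0 : ℝ), (0 : ℝ)))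

/-- The connection along the base curve, applied to a field that comes from the variation. -/
theorem coords_covDerivAlong_baseCurve
    (cov : CovariantDerivative 𝓘(ℝ, E) E (fun x : M ↦ TangentSpace 𝓘(ℝ, E) x)) (hab : a < b)
    (hε₁ : 0 < ε₁) (hε₂ : 0 < ε₂) (ht : t ∈ Icc a b)
    (hx : baseCurve α t ∈ (chartAt E x₀).source) (v : ℝ × ℝ × ℝ)
    {V : Π t : ℝ, TangentSpace 𝓘(ℝ, E) (baseCurve α t)}
    (hV : ∀ s ∈ Icc a b, V s = pushforward (variationDomain a b ε₁ ε₂) α v (s, 0, 0)) :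
    coords x₀ (baseCurve α t) (covDerivAlong cov (baseCurve α) (Icc a b) V t 1) =
      fderivWithin ℝ (fun q ↦ fderivWithin ℝ (variationCoords (E := E) x₀ α)
        (variationDomain a b ε₁ ε₂) q v) (variationDomain a b ε₁ ε₂) (t, 0, 0)
        (1, 0, 0)
      + christoffel cov x₀ (variationCoords x₀ α (t, 0, 0))
        (fderivWithin ℝ (variationCoords (E := E) x₀ α) (variationDomain a b ε₁ ε₂) (t, 0, 0) v)
        (fderivWithin ℝ (variationCoords (E := E) x₀ α) (variationDomain a b ε₁ ε₂) (t, 0, 0)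
          (1, 0, 0)) := by
  have h01 : (0 : ℝ) ∈ Ioo (-ε₁) ε₁ := ⟨neg_neg_of_pos hε₁, hε₁⟩
  have h02 : (0 : ℝ) ∈ Ioo (-ε₂) ε₂ := ⟨neg_neg_of_pos hε₂, hε₂⟩
  have hp : (t, (0 : ℝ), (0 : ℝ)) ∈ variationDomain a b ε₁ ε₂ := ⟨ht, h01, h02⟩
  have hS := uniqueDiffOn_Icc hab t ht
  have hι : ContMDiffWithinAt 𝓘(ℝ, ℝ) 𝓘(ℝ, ℝ × ℝ × ℝ) ∞ (fun s : ℝ ↦ (s, (0 : ℝ), (0 : ℝ)))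
      (Icc a b) t :=
    ((contDiff_id.prodMk (contDiff_const (c := ((0 : ℝ), (0 : ℝ))))).contMDiff t).contMDiffWithinAt
  have hγ : ContMDiffWithinAt 𝓘(ℝ, ℝ) 𝓘(ℝ, E) ∞ (baseCurve α) (Icc a b) t :=
    ContMDiffWithinAt.comp t (hα (t, 0, 0) hp) hι fun s hs ↦ ⟨hs, h01, h02⟩
  have hγd := hγ.mdifferentiableWithinAt (by simp)
  have h1 : (fun s ↦ coords x₀ (baseCurve α s) (V s)) =ᶠ[𝓝[Icc a b] t]
      fun s ↦ fderivWithin ℝ (variationCoords (E := E) x₀ α) (variationDomain a b ε₁ ε₂) (s, 0, 0)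
        v := by
    filter_upwards [self_mem_nhdsWithin,
      hγ.continuousWithinAt ((chartAt E x₀).open_source.mem_nhds hx)] with s hs hsx
    rw [hV s hs]
    exact coords_pushforward hα hab ⟨hs, h01, h02⟩ hsx v
  have h2 := hasDerivWithinAt_fst h01 h02
    ((contDiffWithinAt_fderivWithin_variationCoords hα hab hp hx v).differentiableWithinAt
      (by simp))
  have h3 : coords x₀ (baseCurve α t) (V t) =
      fderivWithin ℝ (variationCoords (E := E) x₀ α) (variationDomain a b ε₁ ε₂) (t, 0, 0) v := by
    rw [hV t ht]
    exact coords_pushforward hα hab hp hx v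
  have h4 : coords x₀ (baseCurve α t)
      (mfderivWithin 𝓘(ℝ, ℝ) 𝓘(ℝ, E) (baseCurve α) (Icc a b) t (1 : ℝ)) =
      fderivWithin ℝ (variationCoords (E := E) x₀ α) (variationDomain a b ε₁ ε₂) (t, 0, 0)
        (1, 0, 0) := by
    have := velocity_eq_pushforward hα hab ht h01 h02
    rw [velocity] at this
    rw [this]
    exact coords_pushforward hα hab hp hx _
  rw [coords_covDerivAlong hx ht hS hγd
    (h2.differentiableWithinAt.congr_of_eventuallyEq_of_mem h1 ht), h1.fderivWithin_eq_of_mem ht,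
    h3, h4, fderivWithin_derivWithin, h2.derivWithin hS]

end

end VariationCoordinates

/-- Stated for germs so that it can be iterated to second derivatives. -/
theorem fderivWithin_apply_eventuallyEq_fderiv {P G : Type*} [NormedAddCommGroup P]
    [NormedSpace ℝ P] [NormedAddCommGroup G] [NormedSpace ℝ G] {F F' : P → G} {S : Set P} {p : P}
    (hS : S ∈ 𝓝 p) (h : F =ᶠ[𝓝 p] F') (v : P) :
    (fun q ↦ fderivWithin ℝ F S q v) =ᶠ[𝓝 p] fun q ↦ fderiv ℝ F' q v := by
  filter_upwards [eventually_mem_nhds_iff.2 hS, eventually_eventually_nhds.2 h] with q h1 h2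
  rw [fderivWithin_of_mem_nhds h1, Filter.EventuallyEq.fderiv_eq h2]

theorem fderivWithin_apply_eq_fderiv {P G : Type*} [NormedAddCommGroup P]
    [NormedSpace ℝ P] [NormedAddCommGroup G] [NormedSpace ℝ G] {F F' : P → G} {S : Set P} {p : P}
    (hS : S ∈ 𝓝 p) (h : F =ᶠ[𝓝 p] F') (v : P) : fderivWithin ℝ F S p v = fderiv ℝ F' p v :=
  (fderivWithin_apply_eventuallyEq_fderiv hS h v).self_of_nhds

/-! ### The pointwise second variation formula on the manifold -/

section SecondVariation

set_option maxSynthPendingDepth 3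

variable {E : Type*} [NormedAddCommGroup E] [NormedSpace ℝ E]
  [FiniteDimensional ℝ E] [CompleteSpace E]
  {M : Type*} [TopologicalSpace M] [ChartedSpace E M] [IsManifold 𝓘(ℝ, E) ∞ M]
  [RiemannianBundle (fun x : M ↦ TangentSpace 𝓘(ℝ, E) x)]
  [IsContMDiffRiemannianBundle 𝓘(ℝ, E) ∞ E (fun x : M ↦ TangentSpace 𝓘(ℝ, E) x)]

variable (E) in
/-- The energy density `(1/2) |α_*(∂/∂t)|²` of a variation. -/
def energyDensity (a b ε₁ ε₂ : ℝ) (α : ℝ × ℝ × ℝ → M) (q : ℝ × ℝ × ℝ) : ℝ :=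
  (1 / 2 : ℝ) * ‖pushforward (E := E) (variationDomain a b ε₁ ε₂) α (1, 0, 0) q‖ ^ 2

/-- The function `⟨∇^SB_{∂/∂s₁} α_*(∂/∂s₂), α_*(∂/∂t)⟩` on the domain of a variation. -/
def HermitianStructure.transversalTerm (h : HermitianStructure E M) (a b ε₁ ε₂ : ℝ)
    (α : ℝ × ℝ × ℝ → M) (q : ℝ × ℝ × ℝ) : ℝ :=
  inner ℝ
    (covDerivAlong h.stromingerBismut α (variationDomain a b ε₁ ε₂)
      (pushforward (variationDomain a b ε₁ ε₂) α (0, 0, 1)) q (0, 1, 0))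
    (pushforward (variationDomain a b ε₁ ε₂) α (1, 0, 0) q)

variable {a b ε₁ ε₂ : ℝ} {α : ℝ × ℝ × ℝ → M} {x₀ : M} {p : ℝ × ℝ × ℝ} {t s₁ s₂ : ℝ}
  (hα : ContMDiffOn 𝓘(ℝ, ℝ × ℝ × ℝ) 𝓘(ℝ, E) ∞ α (variationDomain a b ε₁ ε₂))
include hα

theorem energyDensity_eventuallyEq (hab : a < b) (hp : p ∈ variationDomain a b ε₁ ε₂)
    (hx : α p ∈ (chartAt E x₀).source) :
    energyDensity E a b ε₁ ε₂ α =ᶠ[𝓝[variationDomain a b ε₁ ε₂] p] fun q ↦ (1 / 2 : ℝ) *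
      metricCoords x₀ (variationCoords x₀ α q)
        (fderivWithin ℝ (variationCoords (E := E) x₀ α) (variationDomain a b ε₁ ε₂) q (1, 0, 0))
        (fderivWithin ℝ (variationCoords (E := E) x₀ α) (variationDomain a b ε₁ ε₂) q
          (1, 0, 0)) := by
  filter_upwards [eventually_mem_chart_source hα hp hx] with q hq
  rw [energyDensity, ← real_inner_self_eq_norm_sq, inner_eq_metricCoords hq.2,
    coords_pushforward hα hab hq.1 hq.2]

theorem transversalTerm_eventuallyEq (h : HermitianStructure E M) (hab : a < b)
    (hp : p ∈ variationDomain a b ε₁ ε₂) (hx : α p ∈ (chartAt E x₀).source) :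
    h.transversalTerm a b ε₁ ε₂ α =ᶠ[𝓝[variationDomain a b ε₁ ε₂] p] fun q ↦
      metricCoords x₀ (variationCoords x₀ α q)
        (fderivWithin ℝ (fun q ↦ fderivWithin ℝ (variationCoords (E := E) x₀ α)
            (variationDomain a b ε₁ ε₂) q (0, 0, 1)) (variationDomain a b ε₁ ε₂) q (0, 1, 0)
          + christoffel h.stromingerBismut x₀ (variationCoords x₀ α q)
            (fderivWithin ℝ (variationCoords (E := E) x₀ α) (variationDomain a b ε₁ ε₂) q
              (0, 0, 1))
            (fderivWithin ℝ (variationCoords (E := E) x₀ α) (variationDomain a b ε₁ ε₂) q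
              (0, 1, 0)))
        (fderivWithin ℝ (variationCoords (E := E) x₀ α) (variationDomain a b ε₁ ε₂) q
          (1, 0, 0)) := by
  filter_upwards [eventually_mem_chart_source hα hp hx] with q hq
  rw [HermitianStructure.transversalTerm, inner_eq_metricCoords hq.2,
    coords_pushforward hα hab hq.1 hq.2,
    coords_covDerivAlong_pushforward hα _ hab hq.1 hq.2]

theorem contDiffWithinAt_comp_variationCoords {G : Type*} [NormedAddCommGroup G] [NormedSpace ℝ G]
    {f : E → G} (hf : ContDiffOn ℝ ∞ f (extChartAt 𝓘(ℝ, E) x₀).target)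
    (hp : p ∈ variationDomain a b ε₁ ε₂) (hx : α p ∈ (chartAt E x₀).source) :
    ContDiffWithinAt ℝ ∞ (fun q ↦ f (variationCoords x₀ α q)) (variationDomain a b ε₁ ε₂) p :=
  (hf.contDiffAt ((isOpen_extChartAt_target x₀).mem_nhds
    (extChartAt_mem_target hx))).comp_contDiffWithinAt p (contDiffWithinAt_variationCoords hα hp hx)

theorem contDiffOn_energyDensity (hab : a < b) :
    ContDiffOn ℝ ∞ (energyDensity E a b ε₁ ε₂ α) (variationDomain a b ε₁ ε₂) := by
  intro p hp
  have hx := mem_chart_source E (α p)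
  have hd := contDiffWithinAt_fderivWithin_variationCoords hα hab hp hx (1, 0, 0)
  exact (contDiffWithinAt_const.mul (((contDiffWithinAt_comp_variationCoords hα
    (contDiffOn_metricCoords _) hp hx).clm_apply hd).clm_apply hd)).congr_of_eventuallyEq_of_mem
    (energyDensity_eventuallyEq hα hab hp hx) hp

theorem contDiffOn_transversalTerm (h : HermitianStructure E M) (hab : a < b) :
    ContDiffOn ℝ ∞ (h.transversalTerm a b ε₁ ε₂ α) (variationDomain a b ε₁ ε₂) := by
  intro p hp
  have hx := mem_chart_source E (α p)
  have hd := contDiffWithinAt_fderivWithin_variationCoords hα hab hp hx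
  have hdd := ((hd (0, 0, 1)).fderivWithin_right (uniqueDiffOn_variationDomain hab) (m := ∞)
    (by simp) hp).clm_apply (contDiffWithinAt_const (c := ((0 : ℝ), (1 : ℝ), (0 : ℝ))))
  have hΓ := contDiffWithinAt_comp_variationCoords hα
    (h.contDiffOn_christoffel_stromingerBismut _) hp hx
  exact (((contDiffWithinAt_comp_variationCoords hα (contDiffOn_metricCoords _) hp hx).clm_apply
    (hdd.add ((hΓ.clm_apply (hd _)).clm_apply (hd _)))).clm_apply
    (hd _)).congr_of_eventuallyEq_of_mem (transversalTerm_eventuallyEq hα h hab hp hx) hp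

/-- The pointwise form of the second variation formula. -/
theorem fderivWithin_fderivWithin_energyDensity (h : HermitianStructure E M) (hab : a < b)
    (hε₁ : 0 < ε₁) (hε₂ : 0 < ε₂) (hγ : IsUnitSpeedGeodesic E a b (baseCurve α))
    (ht : t ∈ Ioo a b) :
    fderivWithin ℝ (fun q ↦ fderivWithin ℝ (energyDensity E a b ε₁ ε₂ α)
      (variationDomain a b ε₁ ε₂) q (0, 0, 1)) (variationDomain a b ε₁ ε₂) (t, 0, 0) (0, 1, 0) =
    h.secondVariationIntegrand a b (baseCurve α)
      (variationField (variationDomain a b ε₁ ε₂) α (0, 1, 0))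
      (variationField (variationDomain a b ε₁ ε₂) α (0, 0, 1)) t
    + fderivWithin ℝ (h.transversalTerm a b ε₁ ε₂ α) (variationDomain a b ε₁ ε₂) (t, 0, 0)
      (1, 0, 0) := by
  have ht' := Ioo_subset_Icc_self ht
  have hN := variationDomain_mem_nhds ht hε₁ hε₂
  have hp := mem_of_mem_nhds hN
  have h01 : (0 : ℝ) ∈ Ioo (-ε₁) ε₁ := hp.2.1
  have h02 : (0 : ℝ) ∈ Ioo (-ε₂) ε₂ := hp.2.2
  -- The chart is the one at the base point itself, as required by `coords_curvature`.
  have hx : α (t, 0, 0) ∈ (chartAt E (baseCurve α t)).source := mem_chart_source E (baseCurve α t)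
  have hO := extChartAt_mem_target hx
  have H := h.isSkewMetricConnection (baseCurve α t)
  have hw := nhdsWithin_eq_nhds.2 hN
  have hE := energyDensity_eventuallyEq hα hab hp hx
  have hB := transversalTerm_eventuallyEq hα h hab hp hx
  have hS := eventually_mem_chart_source hα hp hx
  rw [hw] at hE hB hS
  have hx' : ∀ᶠ q in 𝓝 (t, (0 : ℝ), (0 : ℝ)),
      ContDiffAt ℝ ∞ (variationCoords (E := E) (baseCurve α t) α) q := by
    filter_upwards [eventually_mem_nhds_iff.2 hN, hS] with q h1 h2
    exact (contDiffWithinAt_variationCoords hα h2.1 h2.2).contDiffAt h1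
  have h1 (v : ℝ × ℝ × ℝ) := fderivWithin_apply_eventuallyEq_fderiv hN
    (Filter.EventuallyEq.refl _ (variationCoords (E := E) (baseCurve α t) α)) v
  have h2 (u v : ℝ × ℝ × ℝ) := fderivWithin_apply_eventuallyEq_fderiv hN (h1 v) u
  have e1 (v : ℝ × ℝ × ℝ) := fderivWithin_apply_eq_fderiv hN
    (Filter.EventuallyEq.refl _ (variationCoords (E := E) (baseCurve α t) α)) v
  have e2 (u v : ℝ × ℝ × ℝ) := fderivWithin_apply_eq_fderiv hN (h1 v) u
  have hE' : energyDensity E a b ε₁ ε₂ α =ᶠ[𝓝 (t, 0, 0)] fun q ↦ (1 / 2 : ℝ) *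
      metricCoords (baseCurve α t) (variationCoords (baseCurve α t) α q)
        (fderiv ℝ (variationCoords (E := E) (baseCurve α t) α) q (1, 0, 0))
        (fderiv ℝ (variationCoords (E := E) (baseCurve α t) α) q (1, 0, 0)) := by
    filter_upwards [hE, h1 (1, 0, 0)] with q hq hq'
    rw [hq, hq']
  have hB' : h.transversalTerm a b ε₁ ε₂ α =ᶠ[𝓝 (t, 0, 0)] fun q ↦
      metricCoords (baseCurve α t) (variationCoords (baseCurve α t) α q)
        (derivAlong (christoffel h.stromingerBismut (baseCurve α t))
          (variationCoords (baseCurve α t) α)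
          (fun q ↦ fderiv ℝ (variationCoords (E := E) (baseCurve α t) α) q (0, 0, 1)) (0, 1, 0) q)
        (fderiv ℝ (variationCoords (E := E) (baseCurve α t) α) q (1, 0, 0)) := by
    filter_upwards [hB, h1 (1, 0, 0), h1 (0, 1, 0), h1 (0, 0, 1), h2 (0, 1, 0) (0, 0, 1)]
      with q hq hq1 hq2 hq3 hq4
    rw [hq, hq1, hq2, hq3, hq4, derivAlong]
  have hc (v : ℝ × ℝ × ℝ) : coords (baseCurve α t) (baseCurve α t)
      (variationField (variationDomain a b ε₁ ε₂) α v t) =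
      fderiv ℝ (variationCoords (E := E) (baseCurve α t) α) (t, 0, 0) v :=
    (coords_pushforward hα hab hp hx v).trans (e1 v)
  have hcov (v : ℝ × ℝ × ℝ) : coords (baseCurve α t) (baseCurve α t)
      (covDerivAlong h.stromingerBismut (baseCurve α) (Icc a b)
        (variationField (variationDomain a b ε₁ ε₂) α v) t 1) =
      derivAlong (christoffel h.stromingerBismut (baseCurve α t))
        (variationCoords (baseCurve α t) α)
        (fun q ↦ fderiv ℝ (variationCoords (E := E) (baseCurve α t) α) q v) (1, 0, 0)
        (t, 0, 0) := by
    rw [coords_covDerivAlong_baseCurve hα h.stromingerBismut hab hε₁ hε₂ ht' hx v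
      (V := variationField _ α v) (fun s _ ↦ rfl), e1, e1, e2, derivAlong]
  have hvel {s : ℝ} (hs : s ∈ Icc a b) : velocity (E := E) a b (baseCurve α) s =
      variationField (variationDomain a b ε₁ ε₂) α (1, 0, 0) s :=
    velocity_eq_pushforward hα hab hs h01 h02
  have hgeo : derivAlong (christoffel h.stromingerBismut (baseCurve α t))
      (variationCoords (baseCurve α t) α)
      (fun q ↦ fderiv ℝ (variationCoords (E := E) (baseCurve α t) α) q (1, 0, 0)) (1, 0, 0)
      (t, 0, 0) = 0 := by
    have h3 := coords_covDerivAlong_baseCurve hα leviCivita hab hε₁ hε₂ ht' hx (1, 0, 0)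
      (fun s hs ↦ hvel hs)
    -- The geodesic equation is given for Levi-Civita. Its Christoffel symbol occurs only on the
    -- diagonal (x_t, x_t), where it may be replaced by that of Strominger–Bismut.
    rw [hγ.geodesic t ht', map_zero, e1, e2,
      ← h.christoffel_stromingerBismut_self hx] at h3
    exact h3.symm
  have hΓ := (H.contDiffAt_connection hO).differentiableAt (by simp)
  rw [fderivWithin_apply_eq_fderiv hN (fderivWithin_apply_eventuallyEq_fderiv hN hE' _),
    fderivWithin_apply_eq_fderiv hN hB',
    H.second_variation (x := variationCoords (baseCurve α t) α) hO hx' _ _ _ hgeo,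
      HermitianStructure.secondVariationIntegrand,
    HermitianStructure.torsionSB, HermitianStructure.curvatureSB, hvel ht',
    inner_eq_metricCoords hx, inner_eq_metricCoords hx, inner_eq_metricCoords hx, hcov, hcov,
    coords_torsion hx, coords_curvature rfl hΓ _ _ _ (hc _) (hc _) (hc _)]
  simp only [hc, curvatureCoords]

end SecondVariation

theorem intervalIntegrable_fderivWithin {a b ε₁ ε₂ : ℝ} {f : ℝ × ℝ × ℝ → ℝ} (hab : a < b)
    (hε₁ : 0 < ε₁)
    (hε₂ : 0 < ε₂) (hf : ContDiffOn ℝ ∞ f (variationDomain a b ε₁ ε₂)) (v : ℝ × ℝ × ℝ) :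
    IntervalIntegrable (fun t ↦ fderivWithin ℝ f (variationDomain a b ε₁ ε₂) (t, 0, 0) v)
      volume a b :=
  ContinuousOn.intervalIntegrable_of_Icc hab.le
    ((contDiffOn_fderivWithin_apply hab hf v).continuousOn.comp (by fun_prop) fun _ ht ↦
      ⟨ht, ⟨neg_neg_of_pos hε₁, hε₁⟩, ⟨neg_neg_of_pos hε₂, hε₂⟩⟩)

/-! ### Derivatives of the energy and the boundary terms -/

section SecondVariationFormula

set_option maxSynthPendingDepth 3

variable {E : Type*} [NormedAddCommGroup E] [NormedSpace ℝ E]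
  [FiniteDimensional ℝ E] [CompleteSpace E]
  {M : Type*} [TopologicalSpace M] [ChartedSpace E M] [IsManifold 𝓘(ℝ, E) ∞ M]
  [RiemannianBundle (fun x : M ↦ TangentSpace 𝓘(ℝ, E) x)]
  [IsContMDiffRiemannianBundle 𝓘(ℝ, E) ∞ E (fun x : M ↦ TangentSpace 𝓘(ℝ, E) x)]

variable {a b ε₁ ε₂ : ℝ} {α : ℝ × ℝ × ℝ → M} {t s₁ s₂ : ℝ}
  (hα : ContMDiffOn 𝓘(ℝ, ℝ × ℝ × ℝ) 𝓘(ℝ, E) ∞ α (variationDomain a b ε₁ ε₂))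
include hα

theorem variationEnergy_eq_integral (hab : a < b) (hs₁ : s₁ ∈ Ioo (-ε₁) ε₁)
    (hs₂ : s₂ ∈ Ioo (-ε₂) ε₂) :
    variationEnergy E a b α s₁ s₂ = ∫ t in a..b, energyDensity E a b ε₁ ε₂ α (t, s₁, s₂) := by
  simp only [variationEnergy, energy, energyDensity]
  rw [← intervalIntegral.integral_const_mul]
  refine intervalIntegral.integral_congr fun t ht ↦ ?_
  rw [uIcc_of_le hab.le] at ht
  simp only [velocity_eq_pushforward hα hab ht hs₁ hs₂]

theorem variationEnergy_eventuallyEq (hab : a < b) (hs₁ : s₁ ∈ Ioo (-ε₁) ε₁)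
    (hs₂ : s₂ ∈ Ioo (-ε₂) ε₂) :
    variationEnergy E a b α s₁ =ᶠ[𝓝 s₂]
      fun s ↦ ∫ t in a..b, energyDensity E a b ε₁ ε₂ α (t, s₁, s) := by
  filter_upwards [isOpen_Ioo.mem_nhds hs₂] with s hs
  exact variationEnergy_eq_integral hα hab hs₁ hs

theorem differentiableAt_variationEnergy (hab : a < b) (hs₁ : s₁ ∈ Ioo (-ε₁) ε₁)
    (hs₂ : s₂ ∈ Ioo (-ε₂) ε₂) : DifferentiableAt ℝ (variationEnergy E a b α s₁) s₂ :=
  ((hasDerivAt_integral_snd_snd hab (contDiffOn_energyDensity hα hab) hs₁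
    hs₂).congr_of_eventuallyEq (variationEnergy_eventuallyEq hα hab hs₁ hs₂)).differentiableAt

theorem hasDerivAt_deriv_variationEnergy (hab : a < b) (hε₁ : 0 < ε₁) (hε₂ : 0 < ε₂) :
    HasDerivAt (fun s₁ ↦ deriv (variationEnergy E a b α s₁) 0)
      (∫ t in a..b, fderivWithin ℝ (fun p ↦ fderivWithin ℝ (energyDensity E a b ε₁ ε₂ α)
        (variationDomain a b ε₁ ε₂) p (0, 0, 1)) (variationDomain a b ε₁ ε₂) (t, 0, 0)
        (0, 1, 0)) 0 := by
  refine (hasDerivAt_deriv_integral hab hε₁ hε₂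
    (contDiffOn_energyDensity hα hab)).congr_of_eventuallyEq ?_
  filter_upwards [Ioo_mem_nhds (neg_neg_of_pos hε₁) hε₁] with s hs
  exact (variationEnergy_eventuallyEq hα hab hs ⟨neg_neg_of_pos hε₂, hε₂⟩).deriv_eq

theorem boundaryTerm_eq_transversalTerm (h : HermitianStructure E M) (hab : a < b)
    (hε₁ : 0 < ε₁) (hε₂ : 0 < ε₂) (ht : t ∈ Icc a b) :
    h.boundaryTerm a b ε₁ ε₂ α t = h.transversalTerm a b ε₁ ε₂ α (t, 0, 0) := by
  rw [HermitianStructure.boundaryTerm, HermitianStructure.transversalTerm]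
  congr 1
  exact velocity_eq_pushforward hα hab ht ⟨neg_neg_of_pos hε₁, hε₁⟩ ⟨neg_neg_of_pos hε₂, hε₂⟩

theorem integral_fderivWithin_transversalTerm (h : HermitianStructure E M) (hab : a < b)
    (hε₁ : 0 < ε₁) (hε₂ : 0 < ε₂) :
    ∫ t in a..b, fderivWithin ℝ (h.transversalTerm a b ε₁ ε₂ α) (variationDomain a b ε₁ ε₂)
      (t, 0, 0) (1, 0, 0) = h.boundaryTerm a b ε₁ ε₂ α b - h.boundaryTerm a b ε₁ ε₂ α a := by
  have h01 : (0 : ℝ) ∈ Ioo (-ε₁) ε₁ := ⟨neg_neg_of_pos hε₁, hε₁⟩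
  have h02 : (0 : ℝ) ∈ Ioo (-ε₂) ε₂ := ⟨neg_neg_of_pos hε₂, hε₂⟩
  have hB := contDiffOn_transversalTerm hα h hab
  have hι : MapsTo (fun t : ℝ ↦ (t, (0 : ℝ), (0 : ℝ))) (Icc a b) (variationDomain a b ε₁ ε₂) :=
    fun t ht ↦ ⟨ht, h01, h02⟩
  rw [boundaryTerm_eq_transversalTerm hα h hab hε₁ hε₂ (right_mem_Icc.2 hab.le),
    boundaryTerm_eq_transversalTerm hα h hab hε₁ hε₂ (left_mem_Icc.2 hab.le)]
  refine intervalIntegral.integral_eq_sub_of_hasDerivAt_of_le hab.le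
    (f := fun t ↦ h.transversalTerm a b ε₁ ε₂ α (t, 0, 0))
    (hB.continuousOn.comp (by fun_prop) hι) (fun t ht ↦ ?_) ?_
  · exact (hasDerivWithinAt_fst h01 h02 (hB.differentiableOn (by simp) _
      (hι (Ioo_subset_Icc_self ht)))).hasDerivAt (Icc_mem_nhds ht.1 ht.2)
  · exact intervalIntegrable_fderivWithin hab hε₁ hε₂ hB (1, 0, 0)

/-- The end point terms vanish where the variation is constant. -/
theorem boundaryTerm_eq_zero (h : HermitianStructure E M) (hab : a < b) (hε₁ : 0 < ε₁)
    (hε₂ : 0 < ε₂) (ht : t ∈ Icc a b)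
    (hc : ∀ s₁ ∈ Ioo (-ε₁) ε₁, ∀ s₂ ∈ Ioo (-ε₂) ε₂, α (t, s₁, s₂) = baseCurve α t) :
    h.boundaryTerm a b ε₁ ε₂ α t = 0 := by
  have h01 : (0 : ℝ) ∈ Ioo (-ε₁) ε₁ := ⟨neg_neg_of_pos hε₁, hε₁⟩
  have h02 : (0 : ℝ) ∈ Ioo (-ε₂) ε₂ := ⟨neg_neg_of_pos hε₂, hε₂⟩
  have hp : (t, (0 : ℝ), (0 : ℝ)) ∈ variationDomain a b ε₁ ε₂ := ⟨ht, h01, h02⟩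
  have hx : α (t, 0, 0) ∈ (chartAt E (baseCurve α t)).source := mem_chart_source E (baseCurve α t)
  -- The s₂-derivative must vanish at `(t, s, 0)` for all `s`, not just at 0, because `h2`
  -- differentiates it in s₁. At `s = 0` it also makes the Christoffel term zero.
  have h1 {s : ℝ} (hs : s ∈ Ioo (-ε₁) ε₁) : fderivWithin ℝ
      (variationCoords (E := E) (baseCurve α t) α) (variationDomain a b ε₁ ε₂) (t, s, 0)
      (0, 0, 1) = 0 := by
    have hsx : α (t, s, 0) ∈ (chartAt E (baseCurve α t)).source := by
      rw [hc s hs 0 h02]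
      exact hx
    refine (hasDerivAt_snd_snd ht hs h02 ((contDiffWithinAt_variationCoords hα
      (p := (t, s, 0)) ⟨ht, hs, h02⟩ hsx).differentiableWithinAt (by simp))).unique ?_
    refine (hasDerivAt_const (0 : ℝ) (extChartAt 𝓘(ℝ, E) (baseCurve α t)
      (baseCurve α t))).congr_of_eventuallyEq ?_
    filter_upwards [isOpen_Ioo.mem_nhds h02] with s' hs'
    rw [variationCoords, hc s hs s' hs']
  have h2 : fderivWithin ℝ (fun q ↦ fderivWithin ℝ (variationCoords (E := E) (baseCurve α t) α)
      (variationDomain a b ε₁ ε₂) q (0, 0, 1)) (variationDomain a b ε₁ ε₂) (t, 0, 0)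
      (0, 1, 0) = 0 := by
    refine (hasDerivAt_snd_fst ht h01 h02 ((contDiffWithinAt_fderivWithin_variationCoords hα hab
      hp hx (0, 0, 1)).differentiableWithinAt (by simp))).unique ?_
    refine (hasDerivAt_const (0 : ℝ) (0 : E)).congr_of_eventuallyEq ?_
    filter_upwards [isOpen_Ioo.mem_nhds h01] with s hs
    exact h1 hs
  have h3 := coords_covDerivAlong_pushforward hα h.stromingerBismut hab hp hx (0, 1, 0) (0, 0, 1)
  rw [h1 h01, h2, map_zero, zero_apply, add_zero] at h3
  rw [HermitianStructure.boundaryTerm, coords_injective hx (h3.trans (map_zero _).symm),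
    inner_zero_left]

end SecondVariationFormula

end Hermitian

end

theorem theorem1p1
    {E : Type*} [NormedAddCommGroup E] [NormedSpace ℝ E] [FiniteDimensional ℝ E] [CompleteSpace E]
    {M : Type*} [TopologicalSpace M] [T2Space M] [SecondCountableTopology M]
    [ChartedSpace E M] [IsManifold 𝓘(ℝ, E) ∞ M]
    [RiemannianBundle (fun x : M ↦ TangentSpace 𝓘(ℝ, E) x)]
    [IsContMDiffRiemannianBundle 𝓘(ℝ, E) ∞ E (fun x : M ↦ TangentSpace 𝓘(ℝ, E) x)]
    (h : Hermitian.HermitianStructure E M)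
    (a b ε₁ ε₂ : ℝ) (hab : a < b) (hε₁ : 0 < ε₁) (hε₂ : 0 < ε₂)
    (α : ℝ × ℝ × ℝ → M)
    (hα : ContMDiffOn 𝓘(ℝ, ℝ × ℝ × ℝ) 𝓘(ℝ, E) ∞ α (Hermitian.variationDomain a b ε₁ ε₂))
    (hγ : Hermitian.IsUnitSpeedGeodesic E a b (Hermitian.baseCurve α))
    (V W : Π t : ℝ, TangentSpace 𝓘(ℝ, E) (Hermitian.baseCurve α t))
    (hV : V = Hermitian.variationField (Hermitian.variationDomain a b ε₁ ε₂) α (0, 1, 0))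
    (hW : W = Hermitian.variationField (Hermitian.variationDomain a b ε₁ ε₂) α (0, 0, 1)) :
    -- the integral and the iterated partial derivative exist
    IntervalIntegrable (h.secondVariationIntegrand a b (Hermitian.baseCurve α) V W) volume a b ∧
    (∀ s₁ ∈ Ioo (-ε₁) ε₁, ∀ s₂ ∈ Ioo (-ε₂) ε₂,
      DifferentiableAt ℝ (Hermitian.variationEnergy E a b α s₁) s₂) ∧
    -- the second variation formula
    HasDerivAt (fun s₁ ↦ deriv (Hermitian.variationEnergy E a b α s₁) 0)
      ((∫ t in a..b, h.secondVariationIntegrand a b (Hermitian.baseCurve α) V W t)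
        + (h.boundaryTerm a b ε₁ ε₂ α b - h.boundaryTerm a b ε₁ ε₂ α a)) 0 ∧
    -- the formula for proper variations
    (Hermitian.IsProperVariation a b ε₁ ε₂ α →
      HasDerivAt (fun s₁ ↦ deriv (Hermitian.variationEnergy E a b α s₁) 0)
        (∫ t in a..b, h.secondVariationIntegrand a b (Hermitian.baseCurve α) V W t) 0) := by
  subst hV hW
  have hF := Hermitian.intervalIntegrable_fderivWithin hab hε₁ hε₂
    (Hermitian.contDiffOn_fderivWithin_apply hab (Hermitian.contDiffOn_energyDensity hα hab)
      (0, 0, 1)) (0, 1, 0)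
  have hB := Hermitian.intervalIntegrable_fderivWithin hab hε₁ hε₂
    (Hermitian.contDiffOn_transversalTerm hα h hab) (1, 0, 0)
  have key {t : ℝ} (ht : t ∈ Ioo a b) :=
    Hermitian.fderivWithin_fderivWithin_energyDensity hα h hab hε₁ hε₂ hγ ht
  have hint : IntervalIntegrable (h.secondVariationIntegrand a b (Hermitian.baseCurve α)
      (Hermitian.variationField (Hermitian.variationDomain a b ε₁ ε₂) α (0, 1, 0))
      (Hermitian.variationField (Hermitian.variationDomain a b ε₁ ε₂) α (0, 0, 1))) volume a b := by
    -- By the pointwise formula the integrand is, on the open interval, the difference of two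
    -- functions continuous on `[a, b]`. Its values at the end points do not matter.
    refine (hF.sub hB).congr_uIoo fun t ht ↦ ?_
    rw [uIoo_of_le hab.le] at ht
    exact sub_eq_of_eq_add (key ht)
  have hder := Hermitian.hasDerivAt_deriv_variationEnergy hα hab hε₁ hε₂
  -- The integral of the second derivative of the density splits into the stated integral and that
  -- of a total t-derivative, which gives the boundary terms.
  rw [intervalIntegral.integral_congr_Ioo_of_le hab.le fun t ht ↦ key ht,
    intervalIntegral.integral_add hint hB,
    Hermitian.integral_fderivWithin_transversalTerm hα h hab hε₁ hε₂] at hder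
  refine ⟨hint, fun s₁ hs₁ s₂ hs₂ ↦ Hermitian.differentiableAt_variationEnergy hα hab hs₁ hs₂,
    hder, fun hp ↦ ?_⟩
  rwa [Hermitian.boundaryTerm_eq_zero hα h hab hε₁ hε₂ (right_mem_Icc.2 hab.le)
      fun s₁ hs₁ s₂ hs₂ ↦ (hp s₁ hs₁ s₂ hs₂).2,
    Hermitian.boundaryTerm_eq_zero hα h hab hε₁ hε₂ (left_mem_Icc.2 hab.le)
      fun s₁ hs₁ s₂ hs₂ ↦ (hp s₁ hs₁ s₂ hs₂).1, sub_zero, add_zero] at hder
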